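/- Let $G$ be a countable discrete group with a sofic approximation $\Sigma=(\sigma_n:G\to\mathrm{Sym}(V_n))_{n\ge 1}$: each $V_n$ is a nonempty finite set, and as $n\to\infty$ the proportion of $v\in V_n$ with $\sigma_n^g(\sigma_n^h(v))=\sigma_n^{gh}(v)$ tends to $1$ for all $g,h\in G$, and the proportion with $\sigma_n^g(v)\ne v$ tends to $1$ for all $g\neq e$. *Definitions.* A $G$-system $(X,\mu,T)$ is a standard Borel probability space with a measurable $\mu$-preserving action $T$ of $G$. Choose a compact metric $d$ on $X$ that generates its $\sigma$-algebra, and identify $\mu$ with the law $\tilde\mu$ on $X^G$ (with the compact product topology) of $(T^gx)_{g\in G}$, $x\sim\mu$. For $\mathbf x\in X^{V_n}$ put $\Pi_v^{\sigma_n}(\mathbf x)=(x_{\sigma_n^g(v)})_{g\in G}\in X^G$ and $P^{\sigma_n}_{\mathbf x}=\frac1{|V_n|}\sum_{v}\delta_{\Pi^{\sigma_n}_v(\mathbf x)}$; for a weak$^*$-neighbourhood $\mathcal O$ of $\tilde\mu$ in $\Pr(X^G)$ put $\Omega(\mathcal O,\sigma_n)=\{\mathbf x\in X^{V_n}:P^{\sigma_n}_{\mathbf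 x}\in\mathcal O\}$; and let $d^{(V_n)}(\mathbf x,\mathbf x')=\frac1{|V_n|}\sum_v d(x_v,x'_v)$. Write $\mathrm{cov}_\delta(Z)$ for the least cardinality of a set $F\subseteq Z$ with $Z\subseteq B_\delta(F)$, and $\mathrm{cov}_{\varepsilon,\delta}(m)$ for the least cardinality of a set $F$ with $m(B_\delta(F))>1-\varepsilon$, both with respect to $d^{(V_n)}$. With $\log 0=-\infty$, the sofic entropy and the lower sofic entropy are $$\mathrm h_\Sigma(\mu,T)=\sup_{\delta>0}\inf_{\mathcal O}\limsup_{n\to\infty}\tfrac1{|V_n|}\log\mathrm{cov}_\delta\big(\Omega(\mathcal O,\sigma_n)\big),\qquad \underline{\mathrm h}_\Sigma(\mu,T)=\sup_{\delta>0}\inf_{\mathcal O}\liminf_{n\to\infty}\tfrac1{|V_n|}\log\mathrm{cov}_\delta\big(\Omega(\mathcal O,\sigma_n)\big).$$ Measures $\mu_n\in\Pr(X^{V_n})$ quenched converge to $\tilde\mu$ over $\Sigma$ if for every weak$^*$-neighbourhood $\mathcal O$ of $\tilde\mu$ the proportion of $v\in V_n$ with $(\Pi_v^{\sigma_n})_*\mu_n\in\mathcal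 O$ tends to $1$ and $\mu_n(\Omega(\mathcal O,\sigma_n))\to1$; they doubly-quenched converge to $\tilde\mu$, written $\mu_n\stackrel{\mathrm{dq}}{\to}\tilde\mu$, if $\mu_n\times\mu_n$ (on $(X\times X)^{V_n}$) quenched converges to $\tilde\mu\times\tilde\mu$ (on $(X\times X)^G$). The doubly-quenched model-measure sofic entropy is $$\mathrm h^{\mathrm{dq}}_\Sigma(\mu,T)=\sup\Big\{\sup_{\delta,\varepsilon>0}\limsup_{i\to\infty}\tfrac1{|V_{n_i}|}\log\mathrm{cov}_{\varepsilon,\delta}(\mu_i):\ n_1<n_2<\cdots,\ \mu_i\in\Pr(X^{V_{n_i}}),\ \mu_i\stackrel{\mathrm{dq}}{\to}\tilde\mu\text{ over }(\sigma_{n_i})_{i\ge1}\Big\}.$$ These quantities, with values in $[-\infty,+\infty]$, do not depend on the choice of $d$. **Theorem.** Let $(X,\mu,T)$ and $(Y,\nu,S)$ be $G$-systems such that $\mathrm h_\Sigma(\nu,S)=\underline{\mathrm h}_\Sigma(\nu,S)$. Then $$\mathrm h_\Sigma(\mu\times\nu,T\times S)\ \ge\ \mathrm h^{\mathrm{dq}}_\Sigma(\mu,T)+\mathrm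 h_\Sigma(\nu,S),$$ where the right-hand side is read as $-\infty$ if one of its terms is $-\infty$. The three systems may be given arbitrary compact generating metrics on $X$, on $Y$ and on $X\times Y$, chosen independently of one another. -/

import Mathlib

open MeasureTheory Filter Topology
open scoped ENNReal

noncomputable section

namespace Sofic

universe u v w

/-- The proportion of the elements of a finite set `V` that satisfy `p`, that is, the probability
of `p` under the uniform distribution on `V`. -/
def proportion {V : Type*} [Fintype V] (p : V → Prop) : ℝ :=
  (Nat.card {a : V // p a} : ℝ) / (Fintype.card V : ℝ)

/-- A sofic approximation to a group `G`: nonempty finite sets `V n` and maps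
`σ n : G → Sym (V n)` that are asymptotically multiplicative and asymptotically free. -/
structure SoficApproximation (G : Type u) [Group G] where
  V : ℕ → Type v
  [fintypeV : ∀ n, Fintype (V n)]
  [nonemptyV : ∀ n, Nonempty (V n)]
  σ : ∀ n, G → Equiv.Perm (V n)
  tendsto_mul : ∀ g h : G,
    Tendsto (fun n => proportion fun a : V n => σ n g (σ n h a) = σ n (g * h) a) atTop (𝓝 1)
  tendsto_free : ∀ g : G, g ≠ 1 →
    Tendsto (fun n => proportion fun a : V n => σ n g a ≠ a) atTop (𝓝 1)

attribute [instance] SoficApproximation.fintypeV SoficApproximation.nonemptyV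

/-- The sub-approximation along a strictly increasing sequence of indices. -/
def SoficApproximation.subseq {G : Type u} [Group G] (S : SoficApproximation.{u, v} G)
    (k : ℕ → ℕ) (hk : StrictMono k) : SoficApproximation.{u, v} G where
  V i := S.V (k i)
  σ i := S.σ (k i)
  tendsto_mul g h := (S.tendsto_mul g h).comp hk.tendsto_atTop
  tendsto_free g hg := (S.tendsto_free g hg).comp hk.tendsto_atTop

/-! ### Metrics, covering numbers -/

/-- The Hamming average of the metric of `A` over the finite set `V`. -/
def hammingAvg {V A : Type*} [Fintype V] [MetricSpace A] (x y : V → A) : ℝ :=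
  (∑ a, dist (x a) (y a)) / (Fintype.card V : ℝ)

/-- The `δ`-covering number of a subset `Z` with respect to the distance function `ρ`: the least
cardinality of a subset `F` of `Z` whose `δ`-neighbourhood contains `Z`. -/
def covNum {E : Type*} (ρ : E → E → ℝ) (δ : ℝ) (Z : Set E) : ℕ∞ :=
  ⨅ (F : Finset E) (_ : (F : Set E) ⊆ Z ∧ ∀ z ∈ Z, ∃ y ∈ F, ρ z y < δ), (F.card : ℕ∞)

/-- The `(ε, δ)`-covering number of a probability measure: the least cardinality of a set `F` whose
`δ`-neighbourhood has measure greater than `1 - ε`. -/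
def measCovNum {E : Type*} [MeasurableSpace E] (ρ : E → E → ℝ) (ε δ : ℝ)
    (m : ProbabilityMeasure E) : ℕ∞ :=
  ⨅ (F : Finset E) (_ : 1 - ε < (m : Measure E).real {z | ∃ y ∈ F, ρ z y < δ}), (F.card : ℕ∞)

/-- `(1 / |V|) * log N`, with `log 0 = -∞` and `log ∞ = ∞`. -/
def logRate (V : Type*) [Fintype V] (N : ℕ∞) : EReal :=
  ENNReal.log (N : ℝ≥0∞) / (Fintype.card V : EReal)

/-! ### Good models -/

section Models

variable {G : Type u} {V A B : Type*}

/-- The pullback name at the vertex `a` of `x : V → A`. -/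
def pullbackName (σ : G → Equiv.Perm V) (a : V) (x : V → A) : G → A := fun g => x (σ g a)

theorem measurable_pullbackName [MeasurableSpace A] (σ : G → Equiv.Perm V) (a : V) :
    Measurable (pullbackName σ a : (V → A) → G → A) :=
  measurable_pi_lambda _ fun _ => measurable_pi_apply _

/-- The empirical distribution of `x : V → A`: the average over the vertices of the point masses
at the pullback names. -/
def empirical [MeasurableSpace A] [Fintype V] [Nonempty V] (σ : G → Equiv.Perm V) (x : V → A) :
    ProbabilityMeasure (G → A) :=
  ⟨(Fintype.card V : ℝ≥0∞)⁻¹ • ∑ a, Measure.dirac (pullbackName σ a x), ⟨by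
    simp only [Measure.smul_apply, Measure.finsetSum_apply, measure_univ, Finset.sum_const,
      Finset.card_univ, smul_eq_mul, nsmul_eq_mul, mul_one]
    exact ENNReal.inv_mul_cancel (by simp) (by simp)⟩⟩

/-- The set of the `x : V → A` whose empirical distribution lies in `O`. -/
def goodModels [MeasurableSpace A] [Fintype V] [Nonempty V] (O : Set (ProbabilityMeasure (G → A)))
    (σ : G → Equiv.Perm V) : Set (V → A) :=
  {x | empirical σ x ∈ O}

/-- The product of a measure on `A ^ V` and one on `B ^ V`, as a measure on `(A × B) ^ V`
(the index set `V` need not be finite). -/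
def pairMeasure [MeasurableSpace A] [MeasurableSpace B] (m : ProbabilityMeasure (V → A))
    (m' : ProbabilityMeasure (V → B)) : ProbabilityMeasure (V → A × B) :=
  (m.prod m').map (f := fun p a => (p.1 a, p.2 a))
    (measurable_pi_lambda _ fun a => Measurable.prodMk
      ((measurable_pi_apply a).comp measurable_fst)
      ((measurable_pi_apply a).comp measurable_snd)).aemeasurable

end Models

/-! ### Convergence of measures on model spaces, and entropies of metric processes

The topology on `ProbabilityMeasure` is the weak (weak-star) topology. -/

section MetricProc

variable {G : Type u} [Group G] [Countable G]
  {A : Type w} [MetricSpace A] [CompactSpace A] [MeasurableSpace A] [BorelSpace A]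

/-- Local weak-star convergence over `S` of the measures `m n` on `A ^ (V n)` to `μ`. -/
def LocalWeakConv (S : SoficApproximation.{u, v} G) (m : ∀ n, ProbabilityMeasure (S.V n → A))
    (μ : ProbabilityMeasure (G → A)) : Prop :=
  ∀ O ∈ 𝓝 μ, Tendsto
    (fun n => proportion fun a : S.V n =>
      (m n).map (measurable_pullbackName (S.σ n) a).aemeasurable ∈ O) atTop (𝓝 1)

/-- Quenched convergence over `S`. -/
def QuenchedConv (S : SoficApproximation.{u, v} G) (m : ∀ n, ProbabilityMeasure (S.V n → A))
    (μ : ProbabilityMeasure (G → A)) : Prop :=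
  LocalWeakConv S m μ ∧
    ∀ O ∈ 𝓝 μ, Tendsto
      (fun n => (m n : Measure (S.V n → A)).real (goodModels O (S.σ n))) atTop (𝓝 1)

/-- Doubly-quenched convergence over `S`: the Cartesian squares quenched-converge. -/
def DoublyQuenchedConv (S : SoficApproximation.{u, v} G)
    (m : ∀ n, ProbabilityMeasure (S.V n → A)) (μ : ProbabilityMeasure (G → A)) : Prop :=
  QuenchedConv S (fun n => pairMeasure (m n) (m n)) (pairMeasure μ μ)

/-- Sofic entropy of the metric process with law `μ` on `A ^ G`. -/
def processEntropy (S : SoficApproximation.{u, v} G) (μ : ProbabilityMeasure (G → A)) : EReal :=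
  ⨆ (δ : ℝ) (_ : 0 < δ), ⨅ O ∈ 𝓝 μ,
    limsup (fun n => logRate (S.V n) (covNum hammingAvg δ (goodModels O (S.σ n)))) atTop

/-- Lower sofic entropy of the metric process with law `μ` on `A ^ G`. -/
def lowerProcessEntropy (S : SoficApproximation.{u, v} G) (μ : ProbabilityMeasure (G → A)) :
    EReal :=
  ⨆ (δ : ℝ) (_ : 0 < δ), ⨅ O ∈ 𝓝 μ,
    liminf (fun n => logRate (S.V n) (covNum hammingAvg δ (goodModels O (S.σ n)))) atTop

/-- Doubly-quenched model-measure sofic entropy of the metric process with law `μ` on `A ^ G`;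
the outer supremum is over all sub-approximations and all sequences of measures that
doubly-quenched converge to `μ` over them. -/
def dqProcessEntropy (S : SoficApproximation.{u, v} G) (μ : ProbabilityMeasure (G → A)) : EReal :=
  ⨆ (k : ℕ → ℕ) (hk : StrictMono k)
    (m : ∀ i, ProbabilityMeasure ((S.subseq k hk).V i → A))
    (_ : DoublyQuenchedConv (S.subseq k hk) m μ)
    (δ : ℝ) (_ : 0 < δ) (ε : ℝ) (_ : 0 < ε),
    limsup (fun i => logRate ((S.subseq k hk).V i) (measCovNum hammingAvg ε δ (m i))) atTop

end MetricProc

/-! ### Entropies of systems -/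

/-- A compact metric on `X` that generates the given sigma-algebra as its Borel sigma-algebra. -/
structure CompactGeneratingMetric (X : Type w) [MeasurableSpace X] where
  toMetricSpace : MetricSpace X
  compactSpace : CompactSpace X
  borelSpace : BorelSpace X

/-- The diagonal action on a product is measurable. -/
instance measurableConstSMulProd {G X Y : Type*} [Group G] [MeasurableSpace X] [MeasurableSpace Y] [MulAction G X]
    [MulAction G Y] [MeasurableConstSMul G X] [MeasurableConstSMul G Y] :
    MeasurableConstSMul G (X × Y) :=
  ⟨fun g => ((measurable_const_smul g).comp measurable_fst).prodMk
    ((measurable_const_smul g).comp measurable_snd)⟩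

section System

variable {G : Type u} [Group G] [Countable G]
  {X : Type w} [MeasurableSpace X] [MulAction G X] [MeasurableConstSMul G X]

/-- The law on `X ^ G` of the process associated to the system `(X, μ, G ↷ X)`: the image of `μ`
under the injective equivariant map `x ↦ (g • x)_g`. -/
def orbitProcess (G : Type u) [Group G] {X : Type w} [MeasurableSpace X] [MulAction G X]
    [MeasurableConstSMul G X] (μ : Measure X) [IsProbabilityMeasure μ] :
    ProbabilityMeasure (G → X) :=
  ProbabilityMeasure.map ⟨μ, inferInstance⟩ (f := fun (x : X) (g : G) => g • x)
    (measurable_pi_lambda _ fun g => measurable_const_smul g).aemeasurable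

/-- Sofic entropy of the system `(X, μ, G ↷ X)`, computed with the compact generating metric `d`. -/
def soficEntropy (S : SoficApproximation.{u, v} G) (d : CompactGeneratingMetric X)
    (μ : Measure X) [IsProbabilityMeasure μ] : EReal :=
  letI := d.toMetricSpace
  haveI := d.compactSpace
  haveI := d.borelSpace
  processEntropy S (orbitProcess G μ)

/-- Lower sofic entropy of the system `(X, μ, G ↷ X)`, computed with the metric `d`. -/
def lowerSoficEntropy (S : SoficApproximation.{u, v} G) (d : CompactGeneratingMetric X)
    (μ : Measure X) [IsProbabilityMeasure μ] : EReal :=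
  letI := d.toMetricSpace
  haveI := d.compactSpace
  haveI := d.borelSpace
  lowerProcessEntropy S (orbitProcess G μ)

/-- Doubly-quenched model-measure sofic entropy of the system `(X, μ, G ↷ X)`, computed with the
metric `d`. -/
def dqSoficEntropy (S : SoficApproximation.{u, v} G) (d : CompactGeneratingMetric X)
    (μ : Measure X) [IsProbabilityMeasure μ] : EReal :=
  letI := d.toMetricSpace
  haveI := d.compactSpace
  haveI := d.borelSpace
  dqProcessEntropy S (orbitProcess G μ)

end System

end Sofic

end

/-!
# Doubly-quenched entropy bounds the entropy of products from below

The proof has two independent parts.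

**Counting joint good models.** Let `m n` doubly-quenched converge to `μ`, and let `y` be any good
model for `ν`. Then `(x, y)` is a good model for `μ × ν` for all but few `x` with respect to `m n`.
Indeed, for centred `f`, the second moment of `x ↦ (1 / |V|) * ∑ a, f (x at a) * h (y at a)` is
bounded by the Cauchy–Schwarz inequality in terms of the mean, over independent `x` and `x'`, of
`|(1 / |V|) * ∑ a, f (x at a) * f (x' at a)|`; this bound does not involve `y`, and it tends to `0`
because the pair `(x, x')` is a good model for `μ × μ` with high probability
(`integral_weighted_avg_pow_four_le`, `DoublyQuenchedConv.tendsto_integral_tensor`). Products of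
observables suffice, since their integrals determine the weak topology near a product measure
(`iInf_comap_tensor_le_nhds`). So over each point `y` of a separated set of good models for `ν`
there is a separated set of good models `(x, y)` whose cardinality is at least the covering number
of `m n`, and the numbers multiply (`measCovNum_mul_covNum_le`). Along the subsequence on which the
`m n` are defined, the number of good models for `ν` is controlled by the *lower* sofic entropy
(`dqProcessEntropy_add_lowerProcessEntropy_le`).

**Change of metric.** The given metric on `X × Y` is unrelated to the metrics on `X` and `Y`; only
the Borel sets agree. Sofic entropy is at most as large for one as for the other
(`processEntropy_le_relabel`, in either direction): a good model for one topology becomes one for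
the other after its labels are changed by a map `ψ` of the alphabet that is close to the identity
for both metrics in mean and is almost everywhere locally constant (`exists_discretization`). Local constancy makes the push-forward of laws under `ψ` weakly
continuous at the law of the process (`continuousAt_map_of_ae_continuousAt`). That the covering
numbers are comparable at scales chosen before `ψ` follows from the fact that a Borel bijection of
compact metric spaces has a uniformly continuous inverse up to an error that is small in mean
(`exists_dist_le_add_error`).
-/

noncomputable section

namespace Sofic

universe u v

/-! ### Hamming averages, separated sets and covering numbers -/

section Hamming

variable {V A B : Type*} [Fintype V] [MetricSpace A] [MetricSpace B]

theorem hammingAvg_self (x : V → A) : hammingAvg x x = 0 := by simp [hammingAvg]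

theorem hammingAvg_comm (x y : V → A) : hammingAvg x y = hammingAvg y x := by
  simp [hammingAvg, dist_comm]

theorem hammingAvg_triangle (x y z : V → A) :
    hammingAvg x z ≤ hammingAvg x y + hammingAvg y z := by
  unfold hammingAvg
  rw [← add_div, ← Finset.sum_add_distrib]
  gcongr
  exact dist_triangle _ _ _

theorem hammingAvg_fst_le (z w : V → A × B) :
    hammingAvg (fun a => (z a).1) (fun a => (w a).1) ≤ hammingAvg z w := by
  unfold hammingAvg
  gcongr
  exact le_max_left _ _

theorem hammingAvg_snd_le (z w : V → A × B) :
    hammingAvg (fun a => (z a).2) (fun a => (w a).2) ≤ hammingAvg z w := by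
  unfold hammingAvg
  gcongr
  exact le_max_right _ _

end Hamming

section Covering

variable {E : Type*} {ρ : E → E → ℝ} {δ : ℝ}

/-- Greedy choice of separated sets: if no subset of `A` with fewer than `N` elements covers `A`
up to distance `δ`, then `A` contains `δ`-separated sets of every finite cardinality up to `N`. -/
theorem exists_separated (hself : ∀ x, ρ x x = 0) (hcomm : ∀ x y, ρ x y = ρ y x) (hδ : 0 < δ)
    {A : Set E} {N : ℕ∞}
    (h : ∀ F : Finset E, (F : Set E) ⊆ A → (F.card : ℕ∞) < N → ∃ z ∈ A, ∀ y ∈ F, δ ≤ ρ z y)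
    (k : ℕ) (hk : (k : ℕ∞) ≤ N) :
    ∃ F : Finset E, (F : Set E) ⊆ A ∧ F.card = k ∧ ∀ x ∈ F, ∀ y ∈ F, x ≠ y → δ ≤ ρ x y := by
  classical
  induction k with
  | zero => exact ⟨∅, by simp, by simp, by simp⟩
  | succ k ih =>
    have hlt : (k : ℕ∞) < N := lt_of_lt_of_le (by exact_mod_cast Nat.lt_succ_self k) hk
    obtain ⟨F, hFA, hFk, hF⟩ := ih hlt.le
    obtain ⟨z, hzA, hz⟩ := h F hFA (by rwa [hFk])
    have hzF : z ∉ F := fun hmem => by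
      have := hz z hmem
      rw [hself] at this
      exact absurd this (not_le.2 hδ)
    refine ⟨insert z F, ?_, by rw [Finset.card_insert_of_notMem hzF, hFk], ?_⟩
    · rw [Finset.coe_insert]
      exact Set.insert_subset hzA hFA
    · intro x hx y hy hxy
      rcases Finset.mem_insert.1 hx with hxz | hxF <;> rcases Finset.mem_insert.1 hy with hyz | hyF
      · exact absurd (hxz.trans hyz.symm) hxy
      · rw [hxz]; exact hz y hyF
      · rw [hyz, hcomm]; exact hz x hxF
      · exact hF x hxF y hyF hxy

theorem exists_separated_of_le_covNum (hself : ∀ x, ρ x x = 0) (hcomm : ∀ x y, ρ x y = ρ y x)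
    (hδ : 0 < δ) {Z : Set E} (k : ℕ) (hk : (k : ℕ∞) ≤ covNum ρ δ Z) :
    ∃ F : Finset E, (F : Set E) ⊆ Z ∧ F.card = k ∧ ∀ x ∈ F, ∀ y ∈ F, x ≠ y → δ ≤ ρ x y := by
  refine exists_separated hself hcomm hδ (fun F hFZ hF => ?_) k hk
  by_contra! hcon
  exact absurd hF (not_lt.2 (iInf₂_le F ⟨hFZ, hcon⟩))

theorem exists_separated_of_le_measCovNum [MeasurableSpace E] (hself : ∀ x, ρ x x = 0)
    (hcomm : ∀ x y, ρ x y = ρ y x) (hδ : 0 < δ) {ε : ℝ} {m : ProbabilityMeasure E} {A : Set E}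
    (hA : 1 - ε < (m : Measure E).real A) (k : ℕ) (hk : (k : ℕ∞) ≤ measCovNum ρ ε δ m) :
    ∃ F : Finset E, (F : Set E) ⊆ A ∧ F.card = k ∧ ∀ x ∈ F, ∀ y ∈ F, x ≠ y → δ ≤ ρ x y := by
  refine exists_separated hself hcomm hδ (fun F _ hF => ?_) k hk
  by_contra! hcon
  exact absurd hF (not_lt.2 (iInf₂_le F (hA.trans_le (measureReal_mono hcon))))

/-- A `δ`-separated subset has at most as many elements as a `δ / 2`-covering. -/
theorem card_le_covNum (hcomm : ∀ x y, ρ x y = ρ y x)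
    (htri : ∀ x y z, ρ x z ≤ ρ x y + ρ y z) {Z : Set E} {F : Finset E} (hFZ : (F : Set E) ⊆ Z)
    (hF : ∀ x ∈ F, ∀ y ∈ F, x ≠ y → δ ≤ ρ x y) : (F.card : ℕ∞) ≤ covNum ρ (δ / 2) Z := by
  refine le_iInf₂ fun F' hF' => ?_
  have h : ∀ x : E, ∃ y, x ∈ F → y ∈ F' ∧ ρ x y < δ / 2 := fun x => by
    by_cases hx : x ∈ F
    · obtain ⟨y, hy⟩ := hF'.2 x (hFZ hx)
      exact ⟨y, fun _ => hy⟩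
    · exact ⟨x, fun h => absurd h hx⟩
  choose f hf using h
  refine Nat.cast_le.2 (Finset.card_le_card_of_injOn f (fun x hx => (hf x hx).1) ?_)
  intro x hx y hy hxy
  by_contra hne
  have h1 := (hf x hx).2
  have h2 := (hf y hy).2
  rw [← hxy, hcomm] at h2
  linarith [hF x hx y hy hne, htri x (f x) y]

/-- If `Ψ` maps `Z` to `Z'` and points of `Z` whose images are `2 * δ'`-close are
`δ`-close, then a `δ'`-covering of `Z'` yields a `δ`-covering of `Z`. The factor `2` is needed because
the centres of the covering of `Z'` need not lie in the image of `Ψ`. -/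
theorem covNum_le_of_map {E' : Type*} {ρ' : E' → E' → ℝ} {δ' : ℝ} {Z : Set E} {Z' : Set E'}
    (hcomm : ∀ x y, ρ' x y = ρ' y x) (htri : ∀ x y z, ρ' x z ≤ ρ' x y + ρ' y z)
    (Ψ : E → E') (hΨ : ∀ z ∈ Z, Ψ z ∈ Z')
    (h : ∀ z ∈ Z, ∀ w ∈ Z, ρ' (Ψ z) (Ψ w) < 2 * δ' → ρ z w < δ) :
    covNum ρ δ Z ≤ covNum ρ' δ' Z' := by
  classical
  rcases Z.eq_empty_or_nonempty with rfl | ⟨z₀, hz₀⟩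
  · exact (iInf₂_le ∅ ⟨by simp, by simp⟩).trans (by simp)
  refine le_iInf₂ fun F' hF' => ?_
  have hex : ∀ f : E', ∃ z ∈ Z, (∃ w ∈ Z, ρ' (Ψ w) f < δ') → ρ' (Ψ z) f < δ' := fun f => by
    by_cases hf : ∃ w ∈ Z, ρ' (Ψ w) f < δ'
    · obtain ⟨w, hw, hwf⟩ := hf
      exact ⟨w, hw, fun _ => hwf⟩
    · exact ⟨z₀, hz₀, fun h => absurd h hf⟩
  choose s hsZ hs using hex
  refine (iInf₂_le (F'.image s) ⟨?_, fun z hz => ?_⟩).trans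
    (Nat.cast_le.2 Finset.card_image_le)
  · rw [Finset.coe_image]
    rintro _ ⟨f, -, rfl⟩
    exact hsZ f
  · obtain ⟨f, hf, hzf⟩ := hF'.2 (Ψ z) (hΨ z hz)
    have h1 := hs f ⟨z, hz, hzf⟩
    rw [hcomm] at h1
    exact ⟨s f, Finset.mem_image_of_mem s hf, h z hz _ (hsZ f) (by
      linarith [htri (Ψ z) f (Ψ (s f))])⟩

theorem ENat_mul_le_of_forall_nat {M N K : ℕ∞}
    (h : ∀ a b : ℕ, (a : ℕ∞) ≤ M → (b : ℕ∞) ≤ N → ((a * b : ℕ) : ℕ∞) ≤ K) : M * N ≤ K := by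
  have top_of : (∀ a : ℕ, (a : ℕ∞) ≤ K) → K = ⊤ := fun hK => ENat.eq_top_iff_forall_ge.2 hK
  induction M using ENat.recTopCoe with
  | top =>
    induction N using ENat.recTopCoe with
    | top => rw [top_of fun a => by simpa using h a 1 le_top le_top]; exact le_top
    | coe n =>
      rcases Nat.eq_zero_or_pos n with rfl | hn
      · simp
      · rw [top_of fun a => by simpa using h a 1 le_top (by exact_mod_cast hn)]; exact le_top
  | coe m =>
    induction N using ENat.recTopCoe with
    | top =>
      rcases Nat.eq_zero_or_pos m with rfl | hm
      · simp
      · rw [top_of fun a => by simpa using h 1 a (by exact_mod_cast hm) le_top]; exact le_top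
    | coe n => simpa using h m n le_rfl le_rfl

end Covering

section LogRate

variable (V : Type*) [Fintype V]

theorem logRate_mono : Monotone (logRate V) := fun _ _ h =>
  EReal.div_le_div_right_of_nonneg (by positivity)
    (ENNReal.log_monotone (ENat.toENNReal_le.2 h))

theorem logRate_mul (M N : ℕ∞) : logRate V (M * N) = logRate V M + logRate V N := by
  unfold logRate
  rw [ENat.toENNReal_mul, ENNReal.log_mul_add, EReal.add_div_of_nonneg_right (by positivity)]

end LogRate

/-- If for every `y ∈ W` the fibre `{x | (x, y) ∈ Z}` has `m`-measure greater than `1 - ε`, then `Z`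
contains, over each point of a `δ₂`-separated subset of `W`, a `δ₁`-separated set as large as
the `(ε, δ₁)`-covering number of `m`, and the union of these sets is separated. -/
theorem measCovNum_mul_covNum_le {V A B : Type*} [Fintype V] [MetricSpace A] [MetricSpace B]
    [MeasurableSpace A] {m : ProbabilityMeasure (V → A)} {W : Set (V → B)} {Z : Set (V → A × B)}
    {ε δ δ₁ δ₂ : ℝ} (hδ : 0 < δ) (h₁ : δ ≤ δ₁) (h₂ : δ ≤ δ₂)
    (hZ : ∀ y ∈ W, 1 - ε < (m : Measure (V → A)).real {x | (fun a => (x a, y a)) ∈ Z}) :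
    measCovNum hammingAvg ε δ₁ m * covNum hammingAvg δ₂ W ≤ covNum hammingAvg (δ / 2) Z := by
  classical
  refine ENat_mul_le_of_forall_nat fun a b ha hb => ?_
  obtain ⟨F₂, hF₂W, hF₂b, hF₂⟩ := exists_separated_of_le_covNum hammingAvg_self hammingAvg_comm
    (hδ.trans_le h₂) b hb
  have hfib : ∀ y, ∃ F : Finset (V → A), y ∈ F₂ → (F : Set (V → A)) ⊆ {x | (fun a => (x a, y a)) ∈ Z}
      ∧ F.card = a ∧ ∀ x ∈ F, ∀ x' ∈ F, x ≠ x' → δ₁ ≤ hammingAvg x x' := fun y => by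
    by_cases hy : y ∈ F₂
    · obtain ⟨F, hF⟩ := exists_separated_of_le_measCovNum hammingAvg_self hammingAvg_comm
        (hδ.trans_le h₁) (hZ y (hF₂W hy)) a ha
      exact ⟨F, fun _ => hF⟩
    · exact ⟨∅, fun h => absurd h hy⟩
  choose F hF using hfib
  let pr : (Σ _ : V → B, V → A) → V → A × B := fun p a => (p.2 a, p.1 a)
  have hinj : Function.Injective pr := by
    rintro ⟨y, x⟩ ⟨y', x'⟩ h
    have h1 : y = y' := funext fun a => congrArg Prod.snd (congrFun h a)
    have h2 : x = x' := funext fun a => congrArg Prod.fst (congrFun h a)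
    subst h1; subst h2; rfl
  have hcard : ((F₂.sigma F).image pr).card = a * b := by
    rw [Finset.card_image_of_injective _ hinj, Finset.card_sigma,
      Finset.sum_congr rfl fun y hy => (hF y hy).2.1, Finset.sum_const, hF₂b, smul_eq_mul, mul_comm]
  rw [← hcard]
  refine card_le_covNum hammingAvg_comm hammingAvg_triangle ?_ ?_
  · intro z hz
    obtain ⟨⟨y, x⟩, hp, rfl⟩ := Finset.mem_image.1 (Finset.mem_coe.1 hz)
    obtain ⟨hy, hx⟩ := Finset.mem_sigma.1 hp
    exact (hF y hy).1 hx
  · intro z hz w hw hne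
    obtain ⟨⟨y, x⟩, hp, rfl⟩ := Finset.mem_image.1 hz
    obtain ⟨⟨y', x'⟩, hp', rfl⟩ := Finset.mem_image.1 hw
    obtain ⟨hy, hx⟩ := Finset.mem_sigma.1 hp
    obtain ⟨hy', hx'⟩ := Finset.mem_sigma.1 hp'
    by_cases hyy : y = y'
    · subst hyy
      have hxx : x ≠ x' := fun h => hne (by rw [h])
      exact (h₁.trans ((hF y hy).2.2 x hx x' hx' hxx)).trans (hammingAvg_fst_le (pr ⟨y, x⟩) (pr ⟨y, x'⟩))
    · exact (h₂.trans (hF₂ y hy y' hy' hyy)).trans (hammingAvg_snd_le (pr ⟨y, x⟩) (pr ⟨y', x'⟩))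

/-! ### Empirical averages -/

section Empirical

variable {G : Type u} {V A B : Type*} [Fintype V]

/-- The average of the observable `F` over the pullback names of `x`, that is, its integral
against the empirical distribution. -/
def empAvg (σ : G → Equiv.Perm V) (F : (G → A) → ℝ) (x : V → A) : ℝ :=
  (∑ a, F (pullbackName σ a x)) / (Fintype.card V : ℝ)

theorem integral_empirical [Nonempty V] [MeasurableSpace A] (σ : G → Equiv.Perm V)
    {F : (G → A) → ℝ} (hF : Measurable F) (x : V → A) :
    ∫ z, F z ∂(empirical σ x : Measure (G → A)) = empAvg σ F x := by
  have hi : ∀ a ∈ Finset.univ, Integrable F (Measure.dirac (pullbackName σ a x)) := fun a _ =>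
    (integrable_dirac' hF.stronglyMeasurable) (by simp)
  change ∫ z, F z ∂((Fintype.card V : ℝ≥0∞)⁻¹ • ∑ a, Measure.dirac (pullbackName σ a x)) = _
  rw [integral_smul_measure, integral_finsetSum_measure hi]
  simp only [integral_dirac' _ _ hF.stronglyMeasurable, ENNReal.toReal_inv, ENNReal.toReal_natCast,
    smul_eq_mul, empAvg]
  rw [div_eq_inv_mul]

theorem measurable_empAvg [MeasurableSpace A] (σ : G → Equiv.Perm V)
    {F : (G → A) → ℝ} (hF : Measurable F) : Measurable (empAvg σ F : (V → A) → ℝ) :=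
  (Finset.measurable_fun_sum _ fun a _ => hF.comp (measurable_pullbackName σ a)).div_const _

theorem abs_sum_div_card_le [Nonempty V] {f : V → ℝ} {C : ℝ} (h : ∀ a, |f a| ≤ C) :
    |(∑ a, f a) / (Fintype.card V : ℝ)| ≤ C := by
  have hn : (0 : ℝ) < Fintype.card V := by exact_mod_cast Fintype.card_pos
  rw [abs_div, abs_of_pos hn, div_le_iff₀ hn]
  calc |∑ a, f a| ≤ ∑ a, |f a| := Finset.abs_sum_le_sum_abs _ _
    _ ≤ ∑ _a : V, C := Finset.sum_le_sum fun a _ => h a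
    _ = C * Fintype.card V := by simp [mul_comm]

theorem abs_empAvg_le [Nonempty V] (σ : G → Equiv.Perm V) {F : (G → A) → ℝ} {C : ℝ}
    (h : ∀ z, |F z| ≤ C) (x : V → A) : |empAvg σ F x| ≤ C :=
  abs_sum_div_card_le fun _ => h _

end Empirical

/-! ### A second-moment estimate -/

/-- If `|a v| ≤ C` and the average `(1 / |V|) * ∑ a v x * a v x'` is small in mean for independent
`x` and `x'`, then `(1 / |V|) * ∑ a v x * h v` is small in mean, uniformly over the weights
`|h v| ≤ H`. This is the Cauchy–Schwarz inequality, applied to the sum over `v`. -/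
theorem integral_weighted_avg_pow_four_le {Ω V : Type*} [MeasurableSpace Ω] [Fintype V] [Nonempty V]
    (m : Measure Ω) [IsProbabilityMeasure m] {a : V → Ω → ℝ} (ha : ∀ v, Measurable (a v))
    {C H : ℝ} (haC : ∀ v x, |a v x| ≤ C) {h : V → ℝ} (hH : ∀ v, |h v| ≤ H) :
    (∫ x, |(∑ v, a v x * h v) / (Fintype.card V : ℝ)| ∂m) ^ 4 ≤
      C ^ 2 * H ^ 4 *
        ∫ p, |(∑ v, a v p.1 * a v p.2) / (Fintype.card V : ℝ)| ∂(m.prod m) := by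
  obtain ⟨v₀⟩ := ‹Nonempty V›
  obtain ⟨x₀⟩ : Nonempty Ω := nonempty_of_isProbabilityMeasure m
  have hC0 : 0 ≤ C := (abs_nonneg _).trans (haC v₀ x₀)
  have hH0 : 0 ≤ H := (abs_nonneg _).trans (hH v₀)
  set n : ℝ := (Fintype.card V : ℝ) with hn_def
  have hn : 0 < n := by
    rw [hn_def]; exact_mod_cast Fintype.card_pos_iff.2 ⟨v₀⟩
  set g : Ω → ℝ := fun x => (∑ v, a v x * h v) / n with hg_def
  set K : Ω × Ω → ℝ := fun p => (∑ v, a v p.1 * a v p.2) / n with hK_def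
  have hgm : Measurable g :=
    (Finset.measurable_fun_sum _ fun v _ => (ha v).mul_const _).div_const _
  have hKm : Measurable K :=
    (Finset.measurable_fun_sum _ fun v _ =>
      ((ha v).comp measurable_fst).mul ((ha v).comp measurable_snd)).div_const _
  have : Nonempty V := ⟨v₀⟩
  have hgb : ∀ x, |g x| ≤ C * H := fun x => abs_sum_div_card_le fun v => by
    rw [abs_mul]; exact mul_le_mul (haC v x) (hH v) (abs_nonneg _) hC0
  have hKb : ∀ p, |K p| ≤ C * C := fun p => abs_sum_div_card_le fun v => by
    rw [abs_mul]; exact mul_le_mul (haC v _) (haC v _) (abs_nonneg _) hC0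
  have hgi : Integrable g m := Integrable.of_bound hgm.aestronglyMeasurable (C * H) (ae_of_all _ hgb)
  have hg2i : Integrable (fun x => g x ^ 2) m :=
    Integrable.of_bound (hgm.pow_const 2).aestronglyMeasurable ((C * H) ^ 2) (ae_of_all _ fun x => by
      rw [Real.norm_eq_abs, abs_pow]; exact pow_le_pow_left₀ (abs_nonneg _) (hgb x) 2)
  have hagi : ∀ v, Integrable (fun x => a v x * g x) m := fun v =>
    hgi.bdd_mul (ha v).aestronglyMeasurable (ae_of_all _ (haC v))
  have hKi : Integrable K (m.prod m) :=
    Integrable.of_bound hKm.aestronglyMeasurable (C * C) (ae_of_all _ hKb)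
  set t : V → ℝ := fun v => ∫ x, a v x * g x ∂m with ht_def
  have step1 : (∫ x, |g x| ∂m) ^ 2 ≤ ∫ x, g x ^ 2 ∂m := by
    set c := ∫ x, |g x| ∂m with hc
    have h0 : 0 ≤ ∫ x, (|g x| - c) ^ 2 ∂m := integral_nonneg fun x => sq_nonneg _
    have h1 : ∫ x, (|g x| - c) ^ 2 ∂m = (∫ x, g x ^ 2 ∂m) - c ^ 2 := by
      have : ∀ x, (|g x| - c) ^ 2 = g x ^ 2 - 2 * c * |g x| + c ^ 2 := fun x => by
        rw [← sq_abs (g x)]; ring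
      simp_rw [this]
      have hsub : Integrable (fun x => g x ^ 2 - 2 * c * |g x|) m :=
        hg2i.sub (hgi.abs.const_mul _)
      rw [integral_add hsub (integrable_const _), integral_sub hg2i (hgi.abs.const_mul _), integral_const_mul, ← hc]
      simp
      ring
    linarith
  have step2 : ∫ x, g x ^ 2 ∂m = (∑ v, h v * t v) / n := by
    have : ∀ x, g x ^ 2 = (∑ v, h v * (a v x * g x)) / n := fun x => by
      rw [sq]; nth_rewrite 1 [hg_def]
      simp only
      rw [div_mul_eq_mul_div, Finset.sum_mul]
      congr 1
      exact Finset.sum_congr rfl fun v _ => by ring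
    simp_rw [this]
    rw [integral_div, integral_finsetSum _ fun v _ => (hagi v).const_mul _]
    simp_rw [integral_const_mul]
    rfl
  have step3 : (∑ v, t v ^ 2) / n = ∫ p, g p.1 * g p.2 * K p ∂(m.prod m) := by
    have h1 : ∀ p : Ω × Ω, g p.1 * g p.2 * K p =
        (∑ v, (a v p.1 * g p.1) * (a v p.2 * g p.2)) / n := fun p => by
      rw [hK_def]; simp only
      rw [mul_div_assoc', Finset.mul_sum]
      congr 1
      exact Finset.sum_congr rfl fun v _ => by ring
    simp_rw [h1]
    rw [integral_div, integral_finsetSum _ fun v _ => (hagi v).mul_prod (hagi v)]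
    congr 1
    refine Finset.sum_congr rfl fun v _ => ?_
    rw [integral_prod_mul (fun x => a v x * g x) (fun x => a v x * g x), sq]
  have step4 : ∫ p, g p.1 * g p.2 * K p ∂(m.prod m) ≤ (C * H) ^ 2 * ∫ p, |K p| ∂(m.prod m) := by
    rw [← integral_const_mul]
    have hgg : ∀ p : Ω × Ω, |g p.1 * g p.2| ≤ (C * H) ^ 2 := fun p => by
      rw [abs_mul, sq]
      exact mul_le_mul (hgb _) (hgb _) (abs_nonneg _) (by positivity)
    have hggm : Measurable fun p : Ω × Ω => g p.1 * g p.2 :=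
      (hgm.comp measurable_fst).mul (hgm.comp measurable_snd)
    refine integral_mono (hKi.bdd_mul hggm.aestronglyMeasurable (ae_of_all _ hgg))
      (hKi.abs.const_mul _) fun p => ?_
    refine (le_abs_self _).trans ?_
    rw [abs_mul]
    exact mul_le_mul_of_nonneg_right (hgg p) (abs_nonneg _)
  have step5 : ((∑ v, h v * t v) / n) ^ 2 ≤ H ^ 2 * ((∑ v, t v ^ 2) / n) := by
    have h1 := Finset.sum_mul_sq_le_sq_mul_sq Finset.univ h t
    have h2 : ∑ v, h v ^ 2 ≤ n * H ^ 2 := by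
      calc ∑ v, h v ^ 2 ≤ ∑ _v : V, H ^ 2 := Finset.sum_le_sum fun v _ => by
            rw [← sq_abs]; exact pow_le_pow_left₀ (abs_nonneg _) (hH v) 2
        _ = n * H ^ 2 := by simp [hn_def]
    have h3 : 0 ≤ ∑ v, t v ^ 2 := Finset.sum_nonneg fun v _ => sq_nonneg _
    rw [div_pow, div_le_iff₀ (by positivity)]
    calc _ ≤ _ := h1
      _ ≤ n * H ^ 2 * ∑ v, t v ^ 2 := mul_le_mul_of_nonneg_right h2 h3
      _ = _ := by field_simp
  have h0 : 0 ≤ ∫ x, g x ^ 2 ∂m := integral_nonneg fun x => sq_nonneg _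
  calc (∫ x, |g x| ∂m) ^ 4 = ((∫ x, |g x| ∂m) ^ 2) ^ 2 := by ring
    _ ≤ (∫ x, g x ^ 2 ∂m) ^ 2 := pow_le_pow_left₀ (sq_nonneg _) step1 2
    _ ≤ H ^ 2 * ((∑ v, t v ^ 2) / n) := step2 ▸ step5
    _ ≤ H ^ 2 * ((C * H) ^ 2 * ∫ p, |K p| ∂(m.prod m)) :=
        mul_le_mul_of_nonneg_left (step3.trans_le step4) (sq_nonneg _)
    _ = _ := by ring

/-! ### Products of measures on name spaces -/

section Pair

variable {I A B : Type*}

/-- The observable on `(A × B) ^ I` given by the product of observables on `A ^ I` and `B ^ I`. -/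
def tensor (f : (I → A) → ℝ) (h : (I → B) → ℝ) (z : I → A × B) : ℝ :=
  f (fun i => (z i).1) * h (fun i => (z i).2)

variable [MeasurableSpace A] [MeasurableSpace B]

theorem measurable_tensor {f : (I → A) → ℝ} {h : (I → B) → ℝ} (hf : Measurable f)
    (hh : Measurable h) : Measurable (tensor f h) := by
  unfold tensor
  fun_prop

theorem measurable_pairing :
    Measurable fun (p : (I → A) × (I → B)) (i : I) => (p.1 i, p.2 i) := by fun_prop

theorem integral_pairMeasure (μ : ProbabilityMeasure (I → A)) (ν : ProbabilityMeasure (I → B))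
    {F : (I → A × B) → ℝ} (hF : Measurable F) :
    ∫ z, F z ∂(pairMeasure μ ν : Measure (I → A × B)) =
      ∫ p, F (fun i => (p.1 i, p.2 i)) ∂((μ : Measure (I → A)).prod (ν : Measure (I → B))) := by
  unfold pairMeasure
  rw [ProbabilityMeasure.toMeasure_map, integral_map measurable_pairing.aemeasurable
    hF.aestronglyMeasurable]
  rfl

theorem integral_tensor_pairMeasure (μ : ProbabilityMeasure (I → A))
    (ν : ProbabilityMeasure (I → B)) {f : (I → A) → ℝ} {h : (I → B) → ℝ} (hf : Measurable f)
    (hh : Measurable h) :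
    ∫ z, tensor f h z ∂(pairMeasure μ ν : Measure (I → A × B)) =
      (∫ x, f x ∂(μ : Measure (I → A))) * ∫ y, h y ∂(ν : Measure (I → B)) := by
  rw [integral_pairMeasure μ ν (measurable_tensor hf hh), ← integral_prod_mul]
  rfl

end Pair

/-- Near a product measure, the weak topology on `ProbabilityMeasure (G → A × B)` is generated by
the integrals of products of observables: this family of integrals separates the product from the
other points of a compact space. -/
theorem iInf_comap_tensor_le_nhds {G : Type*} [Countable G] {A B : Type*}
    [MetricSpace A] [CompactSpace A] [MeasurableSpace A] [BorelSpace A]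
    [MetricSpace B] [CompactSpace B] [MeasurableSpace B] [BorelSpace B]
    (μ : ProbabilityMeasure (G → A)) (ν : ProbabilityMeasure (G → B)) :
    (⨅ (f : BoundedContinuousFunction (G → A) ℝ) (h : BoundedContinuousFunction (G → B) ℝ),
      comap (fun P : ProbabilityMeasure (G → A × B) => ∫ z, tensor f h z ∂(P : Measure (G → A × B)))
        (𝓝 ((∫ x, f x ∂(μ : Measure (G → A))) * ∫ y, h y ∂(ν : Measure (G → B))))) ≤
      𝓝 (pairMeasure μ ν) := by
  refine le_nhds_of_unique_clusterPt fun P hP => ?_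
  -- the integrals of a cluster point `P` are forced, and they determine `P`
  have key : ∀ (f : BoundedContinuousFunction (G → A) ℝ) (h : BoundedContinuousFunction (G → B) ℝ),
      ∫ z, tensor f h z ∂(P : Measure (G → A × B)) =
        (∫ x, f x ∂(μ : Measure (G → A))) * ∫ y, h y ∂(ν : Measure (G → B)) := fun f h => by
    have hc : Continuous (tensor f h) := by unfold tensor; fun_prop
    have h1 := (ProbabilityMeasure.continuous_integral_continuousMap
      (⟨tensor f h, hc⟩ : C(G → A × B, ℝ))).tendsto P
    have h2 := tendsto_comap.mono_left (iInf₂_le (f := fun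
      (f : BoundedContinuousFunction (G → A) ℝ) (h : BoundedContinuousFunction (G → B) ℝ) =>
      comap (fun P : ProbabilityMeasure (G → A × B) => ∫ z, tensor f h z ∂(P : Measure (G → A × B)))
        (𝓝 ((∫ x, f x ∂(μ : Measure (G → A))) * ∫ y, h y ∂(ν : Measure (G → B))))) f h)
    exact @tendsto_nhds_unique _ _ _ _ _ _ _ _ hP (h1.mono_left inf_le_left)
      (h2.mono_left inf_le_right)
  let e := MeasurableEquiv.arrowProdEquivProdArrow A B G
  have hprod : (P : Measure (G → A × B)).map e =
      (μ : Measure (G → A)).prod (ν : Measure (G → B)) := by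
    have : IsProbabilityMeasure ((P : Measure (G → A × B)).map e) :=
      Measure.isProbabilityMeasure_map e.measurable.aemeasurable
    refine Measure.eq_prod_of_integral_mul_boundedContinuousFunction fun f h => ?_
    rw [integral_map_equiv]
    exact key f h
  apply ProbabilityMeasure.toMeasure_injective
  have : (P : Measure (G → A × B)) = ((P : Measure (G → A × B)).map e).map e.symm := by simp
  rw [this, hprod]
  rfl

/-! ### Doubly-quenched convergence and joint good models -/

section Quenched

variable {G : Type u} [Group G] [Countable G]
  {A : Type*} [MetricSpace A] [CompactSpace A] [MeasurableSpace A] [BorelSpace A]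
  {B : Type*} [MetricSpace B] [CompactSpace B] [MeasurableSpace B] [BorelSpace B]

/-- Under quenched convergence, empirical averages converge in mean. -/
theorem QuenchedConv.tendsto_integral_abs_sub {S : SoficApproximation.{u, v} G}
    {m : ∀ n, ProbabilityMeasure (S.V n → A)} {μ : ProbabilityMeasure (G → A)}
    (hm : QuenchedConv S m μ) {F : (G → A) → ℝ} (hF : Continuous F) {C : ℝ}
    (hC : ∀ z, |F z| ≤ C) :
    Tendsto (fun n => ∫ x, |empAvg (S.σ n) F x - ∫ z, F z ∂(μ : Measure (G → A))|
      ∂(m n : Measure (S.V n → A))) atTop (𝓝 0) := by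
  have hFm : Measurable F := hF.measurable
  set c := ∫ z, F z ∂(μ : Measure (G → A)) with hc
  obtain ⟨z₀⟩ := μ.nonempty
  have hC0 : 0 ≤ C := (abs_nonneg _).trans (hC z₀)
  have hcC : |c| ≤ C := by
    have := norm_integral_le_of_norm_le_const (f := F) (μ := (μ : Measure (G → A)))
      (ae_of_all _ hC)
    simpa using this
  have hcont : Continuous fun P : ProbabilityMeasure (G → A) => ∫ z, F z ∂(P : Measure (G → A)) :=
    ProbabilityMeasure.continuous_integral_continuousMap (⟨F, hF⟩ : C(G → A, ℝ))
  have hdm : ∀ n, Measurable fun x : S.V n → A => |empAvg (S.σ n) F x - c| := fun n =>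
    ((measurable_empAvg (S.σ n) hFm).sub_const c).abs
  have hdb : ∀ n (x : S.V n → A), |empAvg (S.σ n) F x - c| ≤ 2 * C := fun n x =>
    (abs_sub _ _).trans (by linarith [abs_empAvg_le (S.σ n) hC x])
  rw [Metric.tendsto_atTop']
  intro η hη
  set O : Set (ProbabilityMeasure (G → A)) :=
    {P | |∫ z, F z ∂(P : Measure (G → A)) - c| < η / 2} with hO
  have hOn : O ∈ 𝓝 μ := by
    have := hcont.tendsto μ (Metric.ball_mem_nhds _ (half_pos hη))
    exact this
  have hg : ∀ n, goodModels O (S.σ n) = {x : S.V n → A | |empAvg (S.σ n) F x - c| < η / 2} :=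
    fun n => by
      ext x
      change |∫ z, F z ∂(empirical (S.σ n) x : Measure (G → A)) - c| < η / 2 ↔ _
      rw [integral_empirical _ hFm]; rfl
  have hbound : ∀ n, ∫ x, |empAvg (S.σ n) F x - c| ∂(m n : Measure (S.V n → A)) ≤
      η / 2 + 2 * C * (1 - (m n : Measure (S.V n → A)).real (goodModels O (S.σ n))) := fun n => by
    have hms : MeasurableSet (goodModels O (S.σ n)) := by
      rw [hg]; exact measurableSet_lt (hdm n) measurable_const
    rw [← probReal_compl_eq_one_sub hms, ← integral_indicator_one hms.compl, ← integral_const_mul]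
    have : (η / 2 : ℝ) = ∫ _x, η / 2 ∂(m n : Measure (S.V n → A)) := by simp
    rw [this, ← integral_add (integrable_const _)
      (((integrable_const 1).indicator hms.compl).const_mul _)]
    refine integral_mono (Integrable.of_bound (hdm n).aestronglyMeasurable (2 * C)
      (ae_of_all _ fun x => ?_)) ((integrable_const _).add
      (((integrable_const 1).indicator hms.compl).const_mul _)) fun x => ?_
    · rw [Real.norm_eq_abs, abs_abs]; exact hdb n x
    · by_cases hx : x ∈ goodModels O (S.σ n)
      · have hx' : |empAvg (S.σ n) F x - c| < η / 2 := by rw [hg] at hx; exact hx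
        simpa [hx] using hx'.le
      · simpa [hx] using (hdb n x).trans (by linarith)
  have hlim : Tendsto (fun n => η / 2 + 2 * C *
      (1 - (m n : Measure (S.V n → A)).real (goodModels O (S.σ n)))) atTop (𝓝 (η / 2)) := by
    have := ((hm.2 O hOn).const_sub 1).const_mul (2 * C) |>.const_add (η / 2)
    simpa using this
  obtain ⟨N, hN⟩ := eventually_atTop.1 (hlim.eventually (gt_mem_nhds (half_lt_self hη)))
  refine ⟨N, fun n hn => ?_⟩
  rw [Real.dist_0_eq_abs, abs_of_nonneg (integral_nonneg fun x => abs_nonneg _)]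
  exact (hbound n).trans_lt (hN n hn.le)

/-- The filter on the pairs `(n, y)`, with `y` a model over `S.V n`, that describes the limit
`n → ∞` with the empirical distribution of `y` converging to `ν`. -/
def modelFilter (S : SoficApproximation.{u, v} G) (ν : ProbabilityMeasure (G → B)) :
    Filter (Σ n, S.V n → B) :=
  comap Sigma.fst atTop ⊓ comap (fun p => empirical (S.σ p.1) p.2) (𝓝 ν)

/-- If the `m n` doubly-quenched converge to `μ`, then the joint empirical averages of product
observables, over `m n`-random `x` and an arbitrary sequence of good models `y` for `ν`, converge in
mean to the product of the integrals. -/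
theorem DoublyQuenchedConv.tendsto_integral_tensor {S : SoficApproximation.{u, v} G}
    {m : ∀ n, ProbabilityMeasure (S.V n → A)} {μ : ProbabilityMeasure (G → A)}
    (hm : DoublyQuenchedConv S m μ) (ν : ProbabilityMeasure (G → B))
    (f : BoundedContinuousFunction (G → A) ℝ) (h : BoundedContinuousFunction (G → B) ℝ) :
    Tendsto (fun p : Σ n, S.V n → B =>
      ∫ x, |empAvg (S.σ p.1) (tensor f h) (fun a => (x a, p.2 a)) -
        (∫ x, f x ∂(μ : Measure (G → A))) * ∫ y, h y ∂(ν : Measure (G → B))|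
        ∂(m p.1 : Measure (S.V p.1 → A))) (modelFilter S ν) (𝓝 0) := by
  set cf := ∫ x, f x ∂(μ : Measure (G → A)) with hcf
  set ch := ∫ y, h y ∂(ν : Measure (G → B)) with hch
  have hfm : Measurable f := f.continuous.measurable
  have hhm : Measurable h := h.continuous.measurable
  have hfi : Integrable f (μ : Measure (G → A)) := f.integrable _
  -- the centred observable
  set f' : (G → A) → ℝ := fun x => f x - cf with hf'
  have hf'c : Continuous f' := f.continuous.sub continuous_const
  have hf'm : Measurable f' := hf'c.measurable
  set C : ℝ := ‖f‖ + |cf| with hC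
  have hf'b : ∀ x, |f' x| ≤ C := fun x => (abs_sub _ _).trans
    (add_le_add_left (f.norm_coe_le_norm x) _)
  have hhb : ∀ y, |h y| ≤ ‖h‖ := h.norm_coe_le_norm
  set κ : ℕ → ℝ := fun n => ∫ p : (S.V n → A) × (S.V n → A),
    |(∑ a, f' (pullbackName (S.σ n) a p.1) * f' (pullbackName (S.σ n) a p.2)) /
      (Fintype.card (S.V n) : ℝ)|
      ∂((m n : Measure (S.V n → A)).prod (m n : Measure (S.V n → A))) with hκ
  have hκ0 : Tendsto κ atTop (𝓝 0) := by
    have hTc : Continuous (tensor f' f') := by unfold tensor; fun_prop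
    have h1 := QuenchedConv.tendsto_integral_abs_sub hm hTc (C := C * C) fun z => by
      unfold tensor
      rw [abs_mul]
      exact mul_le_mul (hf'b _) (hf'b _) (abs_nonneg _) (by positivity)
    have h2 : ∫ z, tensor f' f' z ∂(pairMeasure μ μ : Measure (G → A × A)) = 0 := by
      rw [integral_tensor_pairMeasure μ μ hf'm hf'm]
      have : ∫ x, f' x ∂(μ : Measure (G → A)) = 0 := by
        rw [hf', integral_sub hfi (integrable_const _)]; simp [hcf]
      rw [this, zero_mul]
    refine h1.congr fun n => ?_
    rw [h2, integral_pairMeasure (m n) (m n)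
      (((measurable_empAvg (S.σ n) hTc.measurable).sub_const 0).abs)]
    simp only [sub_zero]
    rfl
  have hfst : Tendsto (Sigma.fst : (Σ n, S.V n → B) → ℕ) (modelFilter S ν) atTop :=
    tendsto_comap.mono_left inf_le_left
  have hemp : Tendsto (fun p : Σ n, S.V n → B => empAvg (S.σ p.1) h p.2) (modelFilter S ν)
      (𝓝 ch) := by
    have h1 : Tendsto (fun p : Σ n, S.V n → B => empirical (S.σ p.1) p.2) (modelFilter S ν) (𝓝 ν) :=
      tendsto_comap.mono_left inf_le_right
    have h2 := (ProbabilityMeasure.tendsto_iff_forall_integral_tendsto.1 h1) h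
    exact h2.congr fun p => integral_empirical _ hhm _
  set U : (Σ n, S.V n → B) → ℝ := fun p =>
    √(√(C ^ 2 * ‖h‖ ^ 4 * κ p.1)) + |cf| * |empAvg (S.σ p.1) h p.2 - ch| with hU
  have hUlim : Tendsto U (modelFilter S ν) (𝓝 0) := by
    have h1 : Tendsto (fun p : Σ n, S.V n → B => √(√(C ^ 2 * ‖h‖ ^ 4 * κ p.1))) (modelFilter S ν)
        (𝓝 0) := by
      have := ((hκ0.comp hfst).const_mul (C ^ 2 * ‖h‖ ^ 4)).sqrt.sqrt
      simpa using this
    have h2 := ((hemp.sub_const ch).abs).const_mul |cf|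
    simpa using h1.add h2
  refine tendsto_of_tendsto_of_tendsto_of_le_of_le tendsto_const_nhds hUlim
    (fun p => integral_nonneg fun x => abs_nonneg _) fun p => ?_
  obtain ⟨n, y⟩ := p
  change ∫ x, |empAvg (S.σ n) (tensor f h) (fun a => (x a, y a)) - cf * ch|
    ∂(m n : Measure (S.V n → A)) ≤ √(√(C ^ 2 * ‖h‖ ^ 4 * κ n)) + |cf| * |empAvg (S.σ n) h y - ch|
  set g : (S.V n → A) → ℝ := fun x =>
    (∑ a, f' (pullbackName (S.σ n) a x) * h (pullbackName (S.σ n) a y)) /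
      (Fintype.card (S.V n) : ℝ) with hg
  have h4 := integral_weighted_avg_pow_four_le (m n : Measure (S.V n → A))
    (a := fun a x => f' (pullbackName (S.σ n) a x))
    (fun a => hf'm.comp (measurable_pullbackName _ a)) (C := C) (H := ‖h‖) (fun a x => hf'b _)
    (h := fun a => h (pullbackName (S.σ n) a y)) (fun a => hhb _)
  have hgm : Measurable g := (Finset.measurable_fun_sum _ fun a _ =>
    (hf'm.comp (measurable_pullbackName _ a)).mul_const _).div_const _
  have hgi : Integrable g (m n : Measure (S.V n → A)) :=
    Integrable.of_bound hgm.aestronglyMeasurable (C * ‖h‖) (ae_of_all _ fun x =>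
      abs_sum_div_card_le fun a => by
        rw [abs_mul]; exact mul_le_mul (hf'b _) (hhb _) (abs_nonneg _) (by positivity))
  have hgle : ∫ x, |g x| ∂(m n : Measure (S.V n → A)) ≤ √(√(C ^ 2 * ‖h‖ ^ 4 * κ n)) := by
    refine Real.le_sqrt_of_sq_le (Real.le_sqrt_of_sq_le ?_)
    calc _ = (∫ x, |g x| ∂(m n : Measure (S.V n → A))) ^ 4 := by ring
      _ ≤ _ := h4
  have hdec : ∀ x, empAvg (S.σ n) (tensor f h) (fun a => (x a, y a)) - cf * ch =
      g x + cf * (empAvg (S.σ n) h y - ch) := fun x => by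
    have : empAvg (S.σ n) (tensor f h) (fun a => (x a, y a)) = g x + cf * empAvg (S.σ n) h y := by
      rw [hg]
      unfold empAvg
      simp only
      rw [mul_div_assoc', ← add_div, Finset.mul_sum, ← Finset.sum_add_distrib]
      congr 1
      refine Finset.sum_congr rfl fun a _ => ?_
      change f (pullbackName (S.σ n) a x) * h (pullbackName (S.σ n) a y) =
        (f (pullbackName (S.σ n) a x) - cf) * h (pullbackName (S.σ n) a y) +
          cf * h (pullbackName (S.σ n) a y)
      ring
    rw [this]; ring
  calc _ ≤ ∫ x, (|g x| + |cf| * |empAvg (S.σ n) h y - ch|) ∂(m n : Measure (S.V n → A)) := by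
        refine integral_mono ?_ (hgi.abs.add (integrable_const _)) fun x => ?_
        · simp_rw [hdec]; exact (hgi.add (integrable_const _)).abs
        · simp only
          rw [hdec, ← abs_mul]
          exact abs_add_le _ _
    _ = (∫ x, |g x| ∂(m n : Measure (S.V n → A))) + |cf| * |empAvg (S.σ n) h y - ch| := by
        rw [integral_add hgi.abs (integrable_const _)]; simp
    _ ≤ _ := by gcongr

/-- If the `m n` doubly-quenched converge to `μ`, then for every good enough model `y` for `ν`,
with `m n`-probability near `1`, the pair `(x, y)` is a good model for `μ × ν`. -/
theorem DoublyQuenchedConv.eventually_goodModels {S : SoficApproximation.{u, v} G}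
    {m : ∀ n, ProbabilityMeasure (S.V n → A)} {μ : ProbabilityMeasure (G → A)}
    (hm : DoublyQuenchedConv S m μ) (ν : ProbabilityMeasure (G → B))
    {O : Set (ProbabilityMeasure (G → A × B))} (hO : O ∈ 𝓝 (pairMeasure μ ν)) {ε : ℝ}
    (hε : 0 < ε) :
    ∃ O' ∈ 𝓝 ν, ∀ᶠ n in atTop, ∀ y ∈ goodModels O' (S.σ n),
      1 - ε < (m n : Measure (S.V n → A)).real {x | (fun a => (x a, y a)) ∈ goodModels O (S.σ n)} := by
  -- the sets that contain the joint empirical distribution with probability tending to `1`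
  let 𝓗 : Filter (ProbabilityMeasure (G → A × B)) :=
    { sets := {O | ∀ ε : ℝ, 0 < ε → ∀ᶠ p : Σ n, S.V n → B in modelFilter S ν,
        (m p.1 : Measure (S.V p.1 → A)).real
          {x | empirical (S.σ p.1) (fun a => (x a, p.2 a)) ∉ O} < ε}
      univ_sets := fun ε hε => by simp [hε]
      sets_of_superset := fun {O₁ O₂} h hsub ε hε => (h ε hε).mono fun p hp =>
        (measureReal_mono (by intro x hx hx'; exact hx (hsub hx'))).trans_lt hp
      inter_sets := fun {O₁ O₂} h₁ h₂ ε hε => by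
        filter_upwards [h₁ _ (half_pos hε), h₂ _ (half_pos hε)] with p hp₁ hp₂
        refine ((measureReal_mono fun x hx => ?_).trans (measureReal_union_le _ _)).trans_lt
          ((add_lt_add hp₁ hp₂).trans_eq (add_halves ε))
        by_contra hcon
        simp only [Set.mem_union, Set.mem_ofPred_eq, not_or, not_not] at hcon
        exact hx ⟨hcon.1, hcon.2⟩ }
  have h𝓗 : 𝓗 ≤ 𝓝 (pairMeasure μ ν) := by
    refine le_trans (le_iInf₂ fun f h => ?_) (iInf_comap_tensor_le_nhds μ ν)
    rw [← tendsto_iff_comap, Metric.tendsto_nhds]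
    intro η hη ε hε
    have hTm : Measurable (tensor f h) :=
      measurable_tensor f.continuous.measurable h.continuous.measurable
    have hlim := hm.tendsto_integral_tensor ν f h
    filter_upwards [hlim.eventually (gt_mem_nhds (mul_pos hη hε))] with p hp
    obtain ⟨n, y⟩ := p
    set c := (∫ x, f x ∂(μ : Measure (G → A))) * ∫ y, h y ∂(ν : Measure (G → B)) with hc
    have hint : Integrable (fun x => |empAvg (S.σ n) (tensor f h) (fun a => (x a, y a)) - c|)
        (m n : Measure (S.V n → A)) := by
      have hmeas : Measurable fun x : S.V n → A =>
          |empAvg (S.σ n) (tensor f h) (fun a => (x a, y a)) - c| :=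
        (((measurable_empAvg (S.σ n) hTm).comp (by fun_prop :
          Measurable fun (x : S.V n → A) (a : S.V n) => (x a, y a))).sub_const c).abs
      refine Integrable.of_bound hmeas.aestronglyMeasurable (‖f‖ * ‖h‖ + |c|)
        (ae_of_all _ fun x => ?_)
      rw [Real.norm_eq_abs, abs_abs]
      refine (abs_sub _ _).trans (add_le_add_left (abs_empAvg_le _ (fun z => ?_) _) _)
      unfold tensor
      rw [abs_mul]
      exact mul_le_mul (f.norm_coe_le_norm _) (h.norm_coe_le_norm _) (abs_nonneg _) (norm_nonneg _)
    have hmarkov := mul_meas_ge_le_integral_of_nonneg (ae_of_all _ fun x => abs_nonneg _) hint η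
    have hsets : {x : S.V n → A | empirical (S.σ n) (fun a => (x a, y a)) ∉
        {P : ProbabilityMeasure (G → A × B) |
          dist (∫ z, tensor f h z ∂(P : Measure (G → A × B))) c < η}} =
        {x | η ≤ |empAvg (S.σ n) (tensor f h) (fun a => (x a, y a)) - c|} := by
      ext x
      simp only [Set.mem_ofPred_eq, not_lt, integral_empirical _ hTm, Real.dist_eq]
    change (m n : Measure (S.V n → A)).real {x : S.V n → A | empirical (S.σ n)
      (fun a => (x a, y a)) ∉ {P : ProbabilityMeasure (G → A × B) |
          dist (∫ z, tensor f h z ∂(P : Measure (G → A × B))) c < η}} < ε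
    rw [hsets]
    exact lt_of_mul_lt_mul_left (hmarkov.trans_lt hp) hη.le
  have hev := h𝓗 hO ε hε
  obtain ⟨s, ⟨N, hN, hNs⟩, t, ⟨O', hO', hO't⟩, hst⟩ := mem_inf_iff.1 hev
  refine ⟨O', hO', ?_⟩
  filter_upwards [hN] with n hn y hy
  have hmem : (⟨n, y⟩ : Σ n, S.V n → B) ∈ s ∩ t := ⟨hNs hn, hO't hy⟩
  rw [← hst] at hmem
  have hlt : (m n : Measure (S.V n → A)).real
      {x | empirical (S.σ n) (fun a => (x a, y a)) ∉ O} < ε := hmem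
  have hone : (1 : ℝ) = (m n : Measure (S.V n → A)).real Set.univ := by simp
  have hle := (measureReal_mono (μ := (m n : Measure (S.V n → A))) (by
    intro x _
    exact em (empirical (S.σ n) (fun a => (x a, y a)) ∈ O) :
      Set.univ ⊆ {x | (fun a => (x a, y a)) ∈ goodModels O (S.σ n)} ∪
        {x | empirical (S.σ n) (fun a => (x a, y a)) ∉ O})).trans (measureReal_union_le _ _)
  linarith

end Quenched

/-! ### The inequality for metric processes -/

section Processes

variable {G : Type u} [Group G] [Countable G]
  {A : Type*} [MetricSpace A] [CompactSpace A] [MeasurableSpace A] [BorelSpace A]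
  {B : Type*} [MetricSpace B] [CompactSpace B] [MeasurableSpace B] [BorelSpace B]

/-- For the product metric on `A × B`, the doubly-quenched entropy of the first factor and the lower
sofic entropy of the second add up to a lower bound for the sofic entropy of the product. The
lower entropy is needed because the doubly-quenched entropy may be attained along a subsequence. -/
theorem dqProcessEntropy_add_lowerProcessEntropy_le (S : SoficApproximation.{u, v} G)
    (μ : ProbabilityMeasure (G → A)) (ν : ProbabilityMeasure (G → B)) :
    dqProcessEntropy S μ + lowerProcessEntropy S ν ≤ processEntropy S (pairMeasure μ ν) := by
  refine EReal.add_le_of_forall_lt fun a ha b hb => ?_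
  unfold dqProcessEntropy at ha
  simp only [lt_iSup_iff] at ha
  obtain ⟨k, hk, m, hm, δ₁, hδ₁, ε, hε, ha⟩ := ha
  unfold lowerProcessEntropy at hb
  simp only [lt_iSup_iff] at hb
  obtain ⟨δ₂, hδ₂, hb⟩ := hb
  have hδ : 0 < min δ₁ δ₂ := lt_min hδ₁ hδ₂
  unfold processEntropy
  refine le_iSup₂_of_le (min δ₁ δ₂ / 2) (half_pos hδ) (le_iInf₂ fun O hO => ?_)
  obtain ⟨O', hO', hgood⟩ := hm.eventually_goodModels ν hO hε
  have hb' : b < liminf (fun n => logRate (S.V n) (covNum hammingAvg δ₂ (goodModels O' (S.σ n))))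
      atTop := hb.trans_le (iInf₂_le O' hO')
  have hevb := hk.tendsto_atTop.eventually (eventually_lt_of_lt_liminf hb')
  have hfreqa := frequently_lt_of_lt_limsup (by isBoundedDefault) ha
  refine le_limsup_of_frequently_le (hk.tendsto_atTop.frequently
    ((hfreqa.and_eventually (hevb.and hgood)).mono fun i hi => ?_)) (by isBoundedDefault)
  obtain ⟨hi₁, hi₂, hi₃⟩ := hi
  refine (add_le_add hi₁.le hi₂.le).trans ?_
  change logRate (S.V (k i)) _ + _ ≤ _
  rw [← logRate_mul]
  exact logRate_mono _ (measCovNum_mul_covNum_le hδ (min_le_left _ _) (min_le_right _ _) hi₃)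

end Processes

/-! ### Approximation by almost everywhere locally constant maps -/

section Approximation

variable {A : Type*} [MetricSpace A] [CompactSpace A] [MeasurableSpace A] [BorelSpace A]

/-- Measurable sets can be approximated by continuity sets. -/
theorem exists_isOpen_null_frontier_symmDiff_le (m : Measure A) [IsFiniteMeasure m] {s : Set A}
    (hs : MeasurableSet s) {ε : ℝ≥0∞} (hε : ε ≠ 0) :
    ∃ U, IsOpen U ∧ m (frontier U) = 0 ∧ m (symmDiff U s) ≤ ε := by
  have hε2 : ε / 2 ≠ 0 := (ENNReal.half_pos hε).ne'
  obtain ⟨F, hFs, hF, hsF⟩ := hs.exists_isClosed_sdiff_lt (measure_ne_top m s) hε2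
  have hlim := tendsto_measure_thickening_of_isClosed (μ := m) (s := F)
    ⟨1, one_pos, measure_ne_top _ _⟩ hF
  have hlt : m F < m F + ε / 2 := ENNReal.lt_add_right (measure_ne_top _ _) hε2
  obtain ⟨r₀, hr₀, hr⟩ := (mem_nhdsGT_iff_exists_Ioo_subset (a := (0 : ℝ))).1
    (hlim.eventually (gt_mem_nhds hlt))
  obtain ⟨r, hrI, hfr⟩ := exists_null_frontier_thickening m F (show (0 : ℝ) < r₀ from hr₀)
  refine ⟨Metric.thickening r F, Metric.isOpen_thickening, hfr, ?_⟩
  have hFU : F ⊆ Metric.thickening r F := Metric.self_subset_thickening hrI.1 F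
  have h1 : m (Metric.thickening r F \ s) ≤ ε / 2 := by
    calc m (Metric.thickening r F \ s) ≤ m (Metric.thickening r F \ F) :=
          measure_mono (Set.sdiff_subset_sdiff_right hFs)
      _ = m (Metric.thickening r F) - m F :=
          measure_sdiff hFU hF.measurableSet.nullMeasurableSet (measure_ne_top _ _)
      _ ≤ ε / 2 := tsub_le_iff_left.2 (hr hrI).le
  have h2 : m (s \ Metric.thickening r F) ≤ ε / 2 :=
    (measure_mono (Set.sdiff_subset_sdiff_right hFU)).trans hsF.le
  calc _ ≤ _ := measure_union_le _ _
    _ ≤ ε / 2 + ε / 2 := add_le_add h1 h2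
    _ = ε := ENNReal.add_halves ε

/-- A simple function agrees, off a set of small measure, with a measurable function that is almost
everywhere locally constant. -/
theorem exists_ae_locally_const {α : Type*} [MeasurableSpace α] (m : Measure A) [IsFiniteMeasure m]
    (s : SimpleFunc A α) {ε : ℝ≥0∞} (hε : ε ≠ 0) :
    ∃ ψ : A → α, Measurable ψ ∧ (∀ᵐ a ∂m, ∀ᶠ a' in 𝓝 a, ψ a' = ψ a) ∧ m {a | ψ a ≠ s a} ≤ ε := by
  classical
  obtain ⟨ε', hε', hsum⟩ := ENNReal.exists_pos_sum_of_countable' hε s.range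
  choose U hUo hUf hU using fun p : s.range =>
    exists_isOpen_null_frontier_symmDiff_le m (s.measurableSet_fiber p) (hε' p).ne'
  rcases isEmpty_or_nonempty A with hA | ⟨⟨a₀⟩⟩
  · exact ⟨s, s.measurable, ae_of_all _ fun a => hA.elim a, by simp⟩
  -- the value is read off from the collection of the sets `U p` that contain the point
  let T : A → s.range → Prop := fun a p => a ∈ U p
  let c : (s.range → Prop) → α := fun P => if h : ∃ p, P p then (h.choose : α) else s a₀
  have hT : Measurable T := measurable_pi_lambda _ fun p => (hUo p).measurableSet.mem
  refine ⟨fun a => c (T a), (measurable_of_finite c).comp hT, ?_, ?_⟩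
  · have hae : ∀ᵐ a ∂m, ∀ p, a ∉ frontier (U p) :=
      ae_all_iff.2 fun p => measure_eq_zero_iff_ae_notMem.1 (hUf p)
    filter_upwards [hae] with a ha
    have hloc : ∀ p, ∀ᶠ a' in 𝓝 a, (a' ∈ U p ↔ a ∈ U p) := fun p => by
      by_cases hap : a ∈ U p
      · filter_upwards [(hUo p).mem_nhds hap] with a' ha'
        exact ⟨fun _ => hap, fun _ => ha'⟩
      · have hcl : a ∉ closure (U p) := fun h => ha p ⟨h, fun hi => hap (interior_subset hi)⟩
        filter_upwards [isClosed_closure.isOpen_compl.mem_nhds hcl] with a' ha'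
        exact ⟨fun h => absurd (subset_closure h) ha', fun h => absurd h hap⟩
    filter_upwards [eventually_all.2 hloc] with a' ha'
    exact congrArg c (funext fun p => propext (ha' p))
  · have hsub : {a | c (T a) ≠ s a} ⊆ ⋃ p, symmDiff (U p) (s ⁻¹' {(p : α)}) := by
      intro a ha
      by_contra hcon
      simp only [Set.mem_iUnion, not_exists, Set.mem_symmDiff, not_or, not_and, not_not] at hcon
      refine ha ?_
      have hex : ∃ p, T a p := ⟨⟨s a, s.mem_range_self a⟩, (hcon _).2 rfl⟩
      have hval : c (T a) = (hex.choose : α) := dif_pos hex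
      rw [hval]
      exact ((hcon _).1 hex.choose_spec).symm
    calc _ ≤ _ := measure_mono hsub
      _ ≤ ∑' p, m (symmDiff (U p) (s ⁻¹' {(p : α)})) := measure_iUnion_le _
      _ ≤ ∑' p, ε' p := ENNReal.tsum_le_tsum hU
      _ ≤ ε := hsum.le

/-- Discretization of the identity: almost everywhere locally constant maps `ψ k : A → A` whose
composition with a given measurable map `f` to a separable metric space converges to `f` almost
everywhere, even though `f` itself need not be continuous anywhere. -/
theorem exists_discretization [Nonempty A] (m : Measure A) [IsFiniteMeasure m] {W : Type*}
    [MetricSpace W] [SecondCountableTopology W] [MeasurableSpace W] [BorelSpace W]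
    {f : A → W} (hf : Measurable f) :
    ∃ ψ : ℕ → A → A, (∀ k, Measurable (ψ k)) ∧
      (∀ k, ∀ᵐ a ∂m, ∀ᶠ a' in 𝓝 a, ψ k a' = ψ k a) ∧
      ∀ᵐ a ∂m, Tendsto (fun k => f (ψ k a)) atTop (𝓝 (f a)) := by
  classical
  obtain ⟨a₀⟩ := ‹Nonempty A›
  let s := SimpleFunc.approxOn f hf (Set.range f) (f a₀) ⟨a₀, rfl⟩
  have hs : ∀ k a, s k a ∈ Set.range f := fun k a => SimpleFunc.approxOn_mem hf _ k a
  choose! r hr using fun w (hw : w ∈ Set.range f) => hw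
  let t : ℕ → SimpleFunc A A := fun k => (s k).map r
  have ht : ∀ k a, f (t k a) = s k a := fun k a => hr _ (hs k a)
  choose ψ hψm hψc hψ using fun k : ℕ =>
    exists_ae_locally_const m (t k) (ε := (2⁻¹ : ℝ≥0∞) ^ k) (by simp)
  refine ⟨ψ, hψm, hψc, ?_⟩
  have hfin : ∑' k, m {a | ψ k a ≠ t k a} ≠ ∞ := by
    refine ne_top_of_le_ne_top ?_ (ENNReal.tsum_le_tsum hψ)
    rw [ENNReal.tsum_geometric_two]
    exact ENNReal.ofNat_ne_top
  filter_upwards [ae_eventually_notMem hfin] with a ha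
  have hlim : Tendsto (fun k => s k a) atTop (𝓝 (f a)) :=
    SimpleFunc.tendsto_approxOn hf _ (subset_closure ⟨a, rfl⟩)
  refine hlim.congr' (ha.mono fun k hk => ?_)
  have : ψ k a = t k a := not_not.1 hk
  simp only [this, ht]

/-- A measurable bijection between compact metric spaces has a uniformly continuous inverse up to an
error that is small in mean. -/
theorem exists_dist_le_add_error {B : Type*} [MetricSpace B] [CompactSpace B] [MeasurableSpace B]
    [BorelSpace B] (e : A ≃ᵐ B) (m : Measure A) [IsFiniteMeasure m] {η : ℝ} (hη : 0 < η) :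
    ∃ (C : ℝ) (E : A → ℝ) (M : ℝ), 0 ≤ C ∧ Measurable E ∧ (∀ a, |E a| ≤ M) ∧ ∫ a, E a ∂m ≤ η ∧
      ∀ x y, dist x y ≤ η + C * dist (e x) (e y) + E x + E y := by
  classical
  obtain ⟨t, -, htf, ht⟩ := finite_cover_balls_of_compact (isCompact_univ (X := A))
    (show 0 < η / 4 by positivity)
  let ι := htf.toFinset
  have hφm : ∀ p : A, Measurable fun b : B => dist (e.symm b) p := fun p =>
    e.symm.measurable.dist measurable_const
  have hφi : ∀ p : A, Integrable (fun b : B => dist (e.symm b) p) (m.map e) := fun p =>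
    Integrable.of_bound (hφm p).aestronglyMeasurable (Metric.diam (Set.univ : Set A))
      (ae_of_all _ fun b => by
        rw [Real.norm_eq_abs, abs_of_nonneg dist_nonneg]
        exact Metric.dist_le_diam_of_mem isCompact_univ.isBounded trivial trivial)
  have hcard : 0 < η / (ι.card + 1) := by positivity
  choose χ hχ hχi using fun p : A => (hφi p).exists_boundedContinuous_integral_sub_le hcard
  have huc : ∀ p : A, ∃ C : ℝ, 0 ≤ C ∧ ∀ b b', |χ p b - χ p b'| ≤ η / 2 + C * dist b b' := fun p => by
    obtain ⟨δ, hδ, h⟩ := Metric.uniformContinuous_iff.1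
      (CompactSpace.uniformContinuous_of_continuous (χ p).continuous) (η / 2) (half_pos hη)
    refine ⟨2 * ‖χ p‖ / δ, by positivity, fun b b' => ?_⟩
    by_cases hb : dist b b' < δ
    · have := (h hb).le
      rw [Real.dist_eq] at this
      have : 0 ≤ 2 * ‖χ p‖ / δ * dist b b' := by positivity
      linarith
    · have h1 : |χ p b - χ p b'| ≤ 2 * ‖χ p‖ := (χ p).dist_le_two_norm b b'
      have h2 : 2 * ‖χ p‖ ≤ 2 * ‖χ p‖ / δ * dist b b' := by
        rw [div_mul_eq_mul_div, le_div_iff₀ hδ]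
        exact mul_le_mul_of_nonneg_left (not_lt.1 hb) (by positivity)
      linarith
  choose C hC0 hC using huc
  let e' : A → A → ℝ := fun p a => |dist a p - χ p (e a)|
  have he'm : ∀ p, Measurable (e' p) := fun p =>
    ((measurable_id.dist measurable_const).sub ((χ p).continuous.measurable.comp e.measurable)).abs
  have he'b : ∀ p a, |e' p a| ≤ Metric.diam (Set.univ : Set A) + ‖χ p‖ := fun p a => by
    simp only [e', abs_abs]
    refine (abs_sub _ _).trans (add_le_add ?_ ((χ p).norm_coe_le_norm _))
    rw [abs_of_nonneg dist_nonneg]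
    exact Metric.dist_le_diam_of_mem isCompact_univ.isBounded trivial trivial
  have he'i : ∀ p, Integrable (e' p) m := fun p =>
    Integrable.of_bound (he'm p).aestronglyMeasurable _ (ae_of_all _ (he'b p))
  refine ⟨∑ p ∈ ι, C p, fun a => ∑ p ∈ ι, e' p a,
    ∑ p ∈ ι, (Metric.diam (Set.univ : Set A) + ‖χ p‖), Finset.sum_nonneg fun p _ => hC0 p,
    Finset.measurable_fun_sum _ fun p _ => he'm p, fun a => ?_, ?_, fun x y => ?_⟩
  · exact (Finset.abs_sum_le_sum_abs _ _).trans (Finset.sum_le_sum fun p _ => he'b p a)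
  · rw [integral_finsetSum _ fun p _ => he'i p]
    calc ∑ p ∈ ι, ∫ a, e' p a ∂m ≤ ∑ _p ∈ ι, η / (ι.card + 1) := Finset.sum_le_sum fun p _ => by
          have := hχ p
          rw [integral_map_equiv] at this
          simpa [e'] using this
      _ = ι.card * (η / (ι.card + 1)) := by simp
      _ ≤ η := by
          rw [mul_div_assoc', div_le_iff₀ (by positivity)]
          nlinarith
  · obtain ⟨p, hpt, hp⟩ := Set.mem_iUnion₂.1 (ht (Set.mem_univ x))
    have hpι : p ∈ ι := htf.mem_toFinset.2 hpt
    have h0 : ∀ q a, 0 ≤ e' q a := fun q a => abs_nonneg _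
    have hx : e' p x ≤ ∑ q ∈ ι, e' q x := Finset.single_le_sum (fun q _ => h0 q x) hpι
    have hy : e' p y ≤ ∑ q ∈ ι, e' q y := Finset.single_le_sum (fun q _ => h0 q y) hpι
    have hCp : C p * dist (e x) (e y) ≤ (∑ q ∈ ι, C q) * dist (e x) (e y) :=
      mul_le_mul_of_nonneg_right (Finset.single_le_sum (fun q _ => hC0 q) hpι) dist_nonneg
    have h1 := hC p (e x) (e y)
    have h2 : dist x p < η / 4 := hp
    have h3 := dist_triangle_right x y p
    have h4 := neg_abs_le (dist x p - χ p (e x))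
    have h5 := le_abs_self (dist y p - χ p (e y))
    have h6 := neg_abs_le (χ p (e x) - χ p (e y))
    change |dist x p - χ p (e x)| ≤ _ at hx
    change |dist y p - χ p (e y)| ≤ _ at hy
    linarith

end Approximation

/-! ### Weak continuity of almost everywhere continuous operations -/

section WeakContinuity

variable {X : Type*} [TopologicalSpace X] [MeasurableSpace X] [BorelSpace X]
  [HasOuterApproxClosed X]

/-- The continuous mapping theorem for maps that are almost everywhere continuous. -/
theorem continuousAt_map_of_ae_continuousAt {Y : Type*} [TopologicalSpace Y] [MeasurableSpace Y]
    [BorelSpace Y] {P : ProbabilityMeasure X} [(𝓝 P).IsCountablyGenerated]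
    {Φ : X → Y} (hΦ : Measurable Φ) (hc : ∀ᵐ x ∂(P : Measure X), ContinuousAt Φ x) :
    ContinuousAt (fun Q : ProbabilityMeasure X => Q.map hΦ.aemeasurable) P := by
  refine tendsto_of_forall_isOpen_le_liminf' fun U hU => ?_
  have h1 := ProbabilityMeasure.le_liminf_measure_open_of_tendsto (tendsto_id (x := 𝓝 P))
    (isOpen_interior (s := Φ ⁻¹' U))
  have h2 : (P : Measure X) (Φ ⁻¹' U) ≤ (P : Measure X) (interior (Φ ⁻¹' U)) := by
    refine measure_mono_ae (hc.mono fun x hx hxU => ?_)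
    exact mem_interior_iff_mem_nhds.2 (hx.preimage_mem_nhds (hU.mem_nhds hxU))
  simp only [ProbabilityMeasure.toMeasure_map, Measure.map_apply hΦ hU.measurableSet]
  exact h2.trans (h1.trans (liminf_le_liminf (Eventually.of_forall fun Q =>
    measure_mono interior_subset)))

/-- Integration against a bounded, almost everywhere continuous function is weakly continuous. -/
theorem continuousAt_integral_of_ae_continuousAt {P : ProbabilityMeasure X}
    [(𝓝 P).IsCountablyGenerated] {F : X → ℝ} (hF : Measurable F) {M : ℝ} (hM : ∀ x, |F x| ≤ M)
    (hc : ∀ᵐ x ∂(P : Measure X), ContinuousAt F x) :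
    ContinuousAt (fun Q : ProbabilityMeasure X => ∫ x, F x ∂(Q : Measure X)) P := by
  let clamp : BoundedContinuousFunction ℝ ℝ :=
    BoundedContinuousFunction.ofNormedAddCommGroup (fun t => max (-|M|) (min t |M|)) (by fun_prop) |M|
      fun t => abs_le.2 ⟨le_max_left _ _, max_le ((neg_nonpos.2 (abs_nonneg M)).trans (abs_nonneg M)) (min_le_right _ _)⟩
  have h1 := (ProbabilityMeasure.tendsto_iff_forall_integral_tendsto.1
    (continuousAt_map_of_ae_continuousAt hF hc)) clamp
  have h2 : ∀ Q : ProbabilityMeasure X,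
      ∫ t, clamp t ∂(Q.map hF.aemeasurable : Measure ℝ) = ∫ x, F x ∂(Q : Measure X) := fun Q => by
    rw [ProbabilityMeasure.toMeasure_map, integral_map hF.aemeasurable
      clamp.continuous.measurable.aestronglyMeasurable]
    refine integral_congr_ae (ae_of_all _ fun x => ?_)
    have h := abs_le.1 ((hM x).trans (le_abs_self M))
    change max (-|M|) (min (F x) |M|) = F x
    rw [min_eq_left h.2, max_eq_right h.1]
  simp only [h2] at h1
  exact h1

end WeakContinuity

/-! ### Independence of the entropy from the metric -/

section Relabel

variable {G : Type u} {A B : Type*} [MeasurableSpace A] [MeasurableSpace B]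

theorem measurable_relabel {ψ : A → B} (hψ : Measurable ψ) :
    Measurable fun (z : G → A) (g : G) => ψ (z g) :=
  measurable_pi_lambda _ fun g => hψ.comp (measurable_pi_apply g)

/-- The image of a law on `A ^ G` under a coordinatewise relabelling. -/
def relabel {ψ : A → B} (hψ : Measurable ψ) (μ : ProbabilityMeasure (G → A)) :
    ProbabilityMeasure (G → B) :=
  μ.map (measurable_relabel hψ).aemeasurable

theorem relabel_refl (μ : ProbabilityMeasure (G → A)) :
    relabel (MeasurableEquiv.refl A).measurable μ = μ :=
  ProbabilityMeasure.toMeasure_injective Measure.map_id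

theorem toMeasure_empirical {V : Type*} [Fintype V] [Nonempty V] (σ : G → Equiv.Perm V)
    (x : V → A) : (empirical σ x : Measure (G → A)) =
      (Fintype.card V : ℝ≥0∞)⁻¹ • ∑ a, Measure.dirac (pullbackName σ a x) := rfl

theorem empirical_comp {V : Type*} [Fintype V] [Nonempty V] (σ : G → Equiv.Perm V) {ψ : A → B}
    (hψ : Measurable ψ) (z : V → A) :
    empirical σ (fun a => ψ (z a)) = relabel hψ (empirical σ z) := by
  apply ProbabilityMeasure.toMeasure_injective
  unfold relabel
  rw [ProbabilityMeasure.toMeasure_map, toMeasure_empirical, toMeasure_empirical, Measure.map_smul,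
    Measure.map_finset_sum (measurable_relabel hψ).aemeasurable]
  congr 1
  refine Finset.sum_congr rfl fun a _ => ?_
  rw [Measure.map_dirac' (measurable_relabel hψ)]
  rfl

/-- The average over the vertices of a function of the label is the integral of this function of
the label at `1` against the empirical distribution. -/
theorem integral_empirical_eval_one [Group G] {V : Type*} [Fintype V] [Nonempty V] (σ : G → Equiv.Perm V)
    {F : A → ℝ} (hF : Measurable F) (x : V → A) :
    ∫ z, F (z 1) ∂(empirical σ x : Measure (G → A)) =
      (∑ a, F (x a)) / (Fintype.card V : ℝ) := by
  rw [integral_empirical σ (F := fun z => F (z 1)) (hF.comp (measurable_pi_apply 1))]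
  unfold empAvg pullbackName
  rw [Equiv.sum_comp (σ 1) fun a => F (x a)]

end Relabel

section Metrics

variable {G : Type u} [Group G] [Countable G]
  {A : Type*} [MetricSpace A] [CompactSpace A] [MeasurableSpace A] [BorelSpace A]
  {B : Type*} [MetricSpace B] [CompactSpace B] [MeasurableSpace B] [BorelSpace B]

/-- The sofic entropy of a process with alphabet `A` is at most that of the same process with its
labels read in `B` through a Borel isomorphism `e`, which need not be continuous. Applied to `e` and
`e.symm`, this shows that the choice of the compact metric does not matter. The marginals of the law
are required to coincide. A good model for the topology of `A` need not be good for that of `B`, since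
`e` is only measurable; it becomes good after an almost everywhere locally
constant modification `ψ` of the labels, which moves the model by little. -/
theorem processEntropy_le_relabel (S : SoficApproximation.{u, v} G) (e : A ≃ᵐ B)
    (μ : ProbabilityMeasure (G → A)) (m : Measure A) [IsProbabilityMeasure m]
    (hμ : ∀ g : G, MeasurePreserving (fun z : G → A => z g) (μ : Measure (G → A)) m) :
    processEntropy S μ ≤ processEntropy S (relabel e.measurable μ) := by
  have hA : Nonempty A := nonempty_of_isProbabilityMeasure m
  unfold processEntropy
  refine iSup₂_le fun δ hδ => ?_
  set η : ℝ := δ / 10 with hη_def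
  have hη : 0 < η := by positivity
  obtain ⟨C, E, M, hC0, hEm, hEM, hEη, hdist⟩ := exists_dist_le_add_error e m hη
  set δ' : ℝ := η / (2 * (C + 1)) with hδ'_def
  have hδ' : 0 < δ' := by positivity
  have hCδ' : C * (2 * δ') ≤ η := by
    rw [hδ'_def, mul_div_assoc', mul_div_assoc', div_le_iff₀ (by positivity)]
    nlinarith
  refine le_iSup₂_of_le δ' hδ' (le_iInf₂ fun O' hO' => ?_)
  -- the choice of the relabelling `ψ`
  obtain ⟨ψ', hψ'm, hψ'c, hψ'⟩ := exists_discretization m (f := fun a => (a, e a, E a))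
    (measurable_id.prodMk (e.measurable.prodMk hEm))
  have hlim₁ : ∀ᵐ a ∂m, Tendsto (fun k => ψ' k a) atTop (𝓝 a) := hψ'.mono fun a ha =>
    (continuous_fst.tendsto _).comp ha
  have hlim₂ : ∀ᵐ a ∂m, Tendsto (fun k => e (ψ' k a)) atTop (𝓝 (e a)) := hψ'.mono fun a ha =>
    ((continuous_fst.comp continuous_snd).tendsto _).comp ha
  have hlim₃ : ∀ᵐ a ∂m, Tendsto (fun k => E (ψ' k a)) atTop (𝓝 (E a)) := hψ'.mono fun a ha =>
    ((continuous_snd.comp continuous_snd).tendsto _).comp ha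
  have hdiam : ∀ a b : A, |dist a b| ≤ Metric.diam (Set.univ : Set A) := fun a b => by
    rw [abs_of_nonneg dist_nonneg]
    exact Metric.dist_le_diam_of_mem isCompact_univ.isBounded trivial trivial
  have hint₁ : Tendsto (fun k => ∫ a, dist (ψ' k a) a ∂m) atTop (𝓝 0) := by
    have := tendsto_integral_of_dominated_convergence (μ := m) (f := fun _ => (0 : ℝ))
      (F := fun k a => dist (ψ' k a) a) (fun _ => Metric.diam (Set.univ : Set A))
      (fun k => ((hψ'm k).dist measurable_id).aestronglyMeasurable) (integrable_const _)
      (fun k => ae_of_all _ fun a => hdiam _ _)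
      (hlim₁.mono fun a ha => tendsto_iff_dist_tendsto_zero.1 ha)
    simpa using this
  have hint₃ : Tendsto (fun k => ∫ a, E (ψ' k a) ∂m) atTop (𝓝 (∫ a, E a ∂m)) :=
    tendsto_integral_of_dominated_convergence (fun _ => M)
      (fun k => (hEm.comp (hψ'm k)).aestronglyMeasurable) (integrable_const _)
      (fun k => ae_of_all _ fun a => hEM _) hlim₃
  have hmap : Tendsto (fun k => relabel (e.measurable.comp (hψ'm k)) μ) atTop
      (𝓝 (relabel e.measurable μ)) := by
    refine ProbabilityMeasure.tendsto_iff_forall_integral_tendsto.2 fun f => ?_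
    have hfm : Measurable f := f.continuous.measurable
    have h1 : ∀ {φ : A → B} (hφ : Measurable φ), ∫ z, f z ∂(relabel hφ μ : Measure (G → B)) =
        ∫ z, f (fun g => φ (z g)) ∂(μ : Measure (G → A)) := fun hφ => by
      unfold relabel
      rw [ProbabilityMeasure.toMeasure_map, integral_map (measurable_relabel hφ).aemeasurable
        hfm.aestronglyMeasurable]
    simp only [h1]
    have hae : ∀ᵐ z ∂(μ : Measure (G → A)), ∀ g, Tendsto (fun k => e (ψ' k (z g))) atTop
        (𝓝 (e (z g))) := ae_all_iff.2 fun g => (hμ g).quasiMeasurePreserving.ae hlim₂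
    exact tendsto_integral_of_dominated_convergence (fun _ => ‖f‖)
      (fun k => (hfm.comp (measurable_relabel
        (e.measurable.comp (hψ'm k)))).aestronglyMeasurable) (integrable_const _)
      (fun k => ae_of_all _ fun z => f.norm_coe_le_norm _)
      (hae.mono fun z hz => (f.continuous.tendsto _).comp (tendsto_pi_nhds.2 hz))
  obtain ⟨k, hk₁, hk₂, hk₃⟩ := ((hint₁.eventually (gt_mem_nhds hη)).and
    ((hint₃.eventually (gt_mem_nhds (show ∫ a, E a ∂m < 2 * η by linarith))).and
      (hmap.eventually (eventually_eventually_nhds.2 hO')))).exists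
  set ψ := ψ' k with hψ_def
  have hψm : Measurable ψ := hψ'm k
  have hψc : ∀ᵐ a ∂m, ∀ᶠ a' in 𝓝 a, ψ a' = ψ a := hψ'c k
  -- the good models for `O` are relabelled to good models for `O'`
  have hm₁ : Measurable fun a => dist (ψ a) a := hψm.dist measurable_id
  have hm₂ : Measurable fun a => E (ψ a) := hEm.comp hψm
  have hm₃ : Measurable fun a => e (ψ a) := e.measurable.comp hψm
  have hev : MeasurePreserving (fun z : G → A => z 1) (μ : Measure (G → A)) m := hμ 1
  have hμint : ∀ {F : A → ℝ}, Measurable F →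
      ∫ z, F (z 1) ∂(μ : Measure (G → A)) = ∫ a, F a ∂m := fun {F} hF => by
    rw [← hev.map_eq, integral_map hev.measurable.aemeasurable hF.aestronglyMeasurable]
  have hae : ∀ᵐ z ∂(μ : Measure (G → A)), ∀ g, ∀ᶠ a in 𝓝 (z g), ψ a = ψ (z g) :=
    ae_all_iff.2 fun g => (hμ g).quasiMeasurePreserving.ae hψc
  have hc₁ := continuousAt_integral_of_ae_continuousAt (P := μ)
    (F := fun z : G → A => dist (ψ (z 1)) (z 1)) (hm₁.comp (measurable_pi_apply 1))
    (fun z => hdiam _ _) (hae.mono fun z hz =>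
      Tendsto.dist (f := fun z : G → A => ψ (z 1))
        (continuousAt_const.congr (((continuous_apply 1).tendsto z).eventually
          ((hz 1).mono fun a ha => ha.symm))) (continuous_apply 1).continuousAt)
  have hc₂ := continuousAt_integral_of_ae_continuousAt (P := μ)
    (F := fun z : G → A => E (ψ (z 1))) (hm₂.comp (measurable_pi_apply 1))
    (fun z => hEM _) (hae.mono fun z hz =>
      continuousAt_const.congr (((continuous_apply 1).tendsto z).eventually
          ((hz 1).mono fun a ha => congrArg E ha.symm)))
  have hc₃ := continuousAt_map_of_ae_continuousAt (P := μ) (measurable_relabel (G := G) hm₃)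
    (hae.mono fun z hz => continuousAt_pi.2 fun g =>
      continuousAt_const.congr (((continuous_apply g).tendsto z).eventually
          ((hz g).mono fun a ha => congrArg e ha.symm)))
  have hO₁ := hc₁.eventually (gt_mem_nhds ((hμint hm₁).trans_lt hk₁))
  have hO₂ := hc₂.eventually (gt_mem_nhds ((hμint hm₂).trans_lt hk₂))
  have hO₃ := hc₃.eventually hk₃
  refine iInf₂_le_of_le _ (hO₁.and (hO₂.and hO₃)) (limsup_le_limsup (Eventually.of_forall fun n =>
    logRate_mono _ ?_))
  refine covNum_le_of_map hammingAvg_comm hammingAvg_triangle (fun z a => e (ψ (z a)))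
    (fun z hz => ?_) fun z hz w hw hzw => ?_
  · change empirical (S.σ n) (fun a => e (ψ (z a))) ∈ O'
    rw [empirical_comp (S.σ n) hm₃]
    exact hz.2.2
  · have hdisp : ∀ z : S.V n → A, (∫ z, dist (ψ (z 1)) (z 1)
        ∂(empirical (S.σ n) z : Measure (G → A)) < η) → hammingAvg (fun a => ψ (z a)) z < η :=
      fun z hz => by rwa [integral_empirical_eval_one (S.σ n) hm₁] at hz
    have hz₁ := hdisp z hz.1
    have hw₁ := hdisp w hw.1
    have hz₂ : (∑ a, E (ψ (z a))) / (Fintype.card (S.V n) : ℝ) < 2 * η :=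
      integral_empirical_eval_one (S.σ n) hm₂ z ▸ hz.2.1
    have hw₂ : (∑ a, E (ψ (w a))) / (Fintype.card (S.V n) : ℝ) < 2 * η :=
      integral_empirical_eval_one (S.σ n) hm₂ w ▸ hw.2.1
    have hn : (0 : ℝ) < Fintype.card (S.V n) := by exact_mod_cast Fintype.card_pos
    have hmid : hammingAvg (fun a => ψ (z a)) (fun a => ψ (w a)) ≤
        η + C * hammingAvg (fun a => e (ψ (z a))) (fun a => e (ψ (w a))) +
          (∑ a, E (ψ (z a))) / (Fintype.card (S.V n) : ℝ) +
          (∑ a, E (ψ (w a))) / (Fintype.card (S.V n) : ℝ) := by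
      have hsum := Finset.sum_le_sum fun a (_ : a ∈ (Finset.univ : Finset (S.V n))) =>
        hdist (ψ (z a)) (ψ (w a))
      simp only [Finset.sum_add_distrib, ← Finset.mul_sum, Finset.sum_const, Finset.card_univ,
        nsmul_eq_mul] at hsum
      unfold hammingAvg
      rw [div_le_iff₀ hn]
      refine hsum.trans_eq ?_
      field_simp
    have hCle : C * hammingAvg (fun a => e (ψ (z a))) (fun a => e (ψ (w a))) ≤ C * (2 * δ') :=
      mul_le_mul_of_nonneg_left hzw.le hC0
    have ht₁ := hammingAvg_triangle z (fun a => ψ (z a)) w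
    have ht₂ := hammingAvg_triangle (fun a => ψ (z a)) (fun a => ψ (w a)) w
    rw [hammingAvg_comm z (fun a => ψ (z a))] at ht₁
    linarith

end Metrics

/-! ### The inequality for systems -/

section Systems

variable {G : Type u} [Group G]

theorem toMeasure_orbitProcess {X : Type*} [MeasurableSpace X] [MulAction G X]
    [MeasurableConstSMul G X] (ρ : Measure X) [IsProbabilityMeasure ρ] :
    (orbitProcess G ρ : Measure (G → X)) = ρ.map fun x g => g • x := rfl

/-- A process on a compact metric alphabet `A` whose law is carried to that of a system by a
measurable bijection of alphabets has at most the sofic entropy of this system. -/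
theorem processEntropy_le_soficEntropy [Countable G] (S : SoficApproximation.{u, v} G)
    {X : Type*} [MeasurableSpace X] [MulAction G X] [MeasurableConstSMul G X]
    (d : CompactGeneratingMetric X) (ρ : Measure X) [IsProbabilityMeasure ρ]
    [SMulInvariantMeasure G X ρ]
    {A : Type*} [MetricSpace A] [CompactSpace A] [MeasurableSpace A] [BorelSpace A]
    (e : A ≃ᵐ X) (μ : ProbabilityMeasure (G → A))
    (hμ : relabel e.measurable μ = orbitProcess G ρ) :
    processEntropy S μ ≤ soficEntropy S d ρ := by
  let := d.toMetricSpace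
  have := d.compactSpace
  have := d.borelSpace
  have hm : IsProbabilityMeasure (ρ.map e.symm) :=
    Measure.isProbabilityMeasure_map e.symm.measurable.aemeasurable
  unfold soficEntropy
  rw [← hμ]
  refine processEntropy_le_relabel S e μ (ρ.map e.symm) fun g => ⟨measurable_pi_apply g, ?_⟩
  have h1 : (μ : Measure (G → A)).map (fun z g => e (z g)) = ρ.map fun x g => g • x := by
    rw [← toMeasure_orbitProcess, ← hμ]
    unfold relabel
    rw [ProbabilityMeasure.toMeasure_map]
  have h2 := congrArg (Measure.map fun z : G → X => e.symm (z g)) h1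
  have hmeas : Measurable fun z : G → X => e.symm (z g) :=
    e.symm.measurable.comp (measurable_pi_apply g)
  rw [Measure.map_map hmeas (measurable_relabel e.measurable), Measure.map_map hmeas
    (measurable_pi_lambda _ fun g => measurable_const_smul g)] at h2
  have h3 : ((fun z : G → X => e.symm (z g)) ∘ fun (z : G → A) (g : G) => e (z g)) =
      fun z => z g := funext fun z => e.symm_apply_apply (z g)
  rw [h3] at h2
  rw [h2, ← (measurePreserving_smul g ρ).map_eq, Measure.map_map e.symm.measurable
    (measurable_const_smul g), (measurePreserving_smul g ρ).map_eq]
  rfl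

theorem orbitProcess_prod {X Y : Type*} [MeasurableSpace X] [MulAction G X]
    [MeasurableConstSMul G X] [MeasurableSpace Y] [MulAction G Y] [MeasurableConstSMul G Y]
    (μ : Measure X) [IsProbabilityMeasure μ] (ν : Measure Y) [IsProbabilityMeasure ν] :
    pairMeasure (orbitProcess G μ) (orbitProcess G ν) = orbitProcess G (μ.prod ν) := by
  apply ProbabilityMeasure.toMeasure_injective
  have hX : Measurable fun (x : X) (g : G) => g • x :=
    measurable_pi_lambda _ fun g => measurable_const_smul g
  have hY : Measurable fun (y : Y) (g : G) => g • y :=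
    measurable_pi_lambda _ fun g => measurable_const_smul g
  unfold pairMeasure
  rw [ProbabilityMeasure.toMeasure_map]
  change ((μ.map fun x (g : G) => g • x).prod (ν.map fun y (g : G) => g • y)).map _ =
    (μ.prod ν).map fun p (g : G) => g • p
  rw [Measure.map_prod_map _ _ hX hY, Measure.map_map measurable_pairing (hX.prodMap hY)]
  rfl

end Systems

end Sofic

end

/-- The entropies of the three systems do not depend on the compact generating metrics that they are
computed with; accordingly the inequality is claimed for arbitrary compact generating metrics `dX`,
`dY` and `dZ` on `X`, `Y` and `X × Y`. The group acts diagonally on `X × Y`. In `EReal`, a sum with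
a summand `⊥` is `⊥`. -/
theorem theoremB {G : Type*} [Group G] [Countable G] (S : Sofic.SoficApproximation G)
    {X : Type*} [MeasurableSpace X] [StandardBorelSpace X]
    [MulAction G X] [MeasurableConstSMul G X]
    (μ : Measure X) [IsProbabilityMeasure μ] [SMulInvariantMeasure G X μ]
    {Y : Type*} [MeasurableSpace Y] [StandardBorelSpace Y]
    [MulAction G Y] [MeasurableConstSMul G Y]
    (ν : Measure Y) [IsProbabilityMeasure ν] [SMulInvariantMeasure G Y ν]
    (dX : Sofic.CompactGeneratingMetric X) (dY : Sofic.CompactGeneratingMetric Y)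
    (dZ : Sofic.CompactGeneratingMetric (X × Y))
    (hν : Sofic.soficEntropy S dY ν = Sofic.lowerSoficEntropy S dY ν) :
    Sofic.dqSoficEntropy S dX μ + Sofic.soficEntropy S dY ν ≤
      Sofic.soficEntropy S dZ (μ.prod ν) := by
  rw [hν]
  let := dX.toMetricSpace
  have := dX.compactSpace
  have := dX.borelSpace
  let := dY.toMetricSpace
  have := dY.compactSpace
  have := dY.borelSpace
  have hinv : SMulInvariantMeasure G (X × Y) (μ.prod ν) := ⟨fun g s hs => by
    have h := ((measurePreserving_smul g μ).prod (measurePreserving_smul g ν)).measure_preimage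
      hs.nullMeasurableSet
    exact h⟩
  exact (Sofic.dqProcessEntropy_add_lowerProcessEntropy_le S (Sofic.orbitProcess G μ)
    (Sofic.orbitProcess G ν)).trans (Sofic.processEntropy_le_soficEntropy S dZ (μ.prod ν)
      (MeasurableEquiv.refl (X × Y)) _
      ((Sofic.relabel_refl _).trans (Sofic.orbitProcess_prod μ ν)))
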